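/- Let $m,n\ge 0$ and let $\mathrm{R}$ be a rectangle with $2(m+n)$ marked boundary points: $x_1,\dots,x_n$ on the ceiling and $x_1',\dots,x_n'$ on the floor (from left to right), $y_1,\dots,y_m$ on the left side and $y_1',\dots,y_m'$ on the right side (from top to bottom). A Catalan state is a crossingless connection of these points by $m+n$ arcs. Let $L(m,n)$ be the lattice crossing: $n$ vertical lines (joining $x_j$ to $x_j'$) above $m$ horizontal lines (joining $y_i$ to $y_i'$). A Kauffman state $s=(s_{i,j})\in\{1,-1\}^{m\times n}$ assigns a marker to every crossing; the marker $1$ smooths the crossing so that top is joined with right and left with bottom, the marker $-1$ so that top is joined with left and right with bottom. Let $p(s)$, $n(s)$ be the numbers of positive and negative markers, $|D_s|$ the number of closed components of the smoothed diagram $D_s$, and $\mathbf K(s)$ the Catalan state left after removing these components. The coefficient of a Catalan state $C$ in $L(m,n)$ is $$C(A)=\sum_{s\,:\,\mathbf K(s)=C}A^{p(s)-n(s)}(-A^2-A^{-2})^{|D_s|}\in\mathbb Z[A^{\pm1}],$$ and $C$ is realizable if $C=\mathbf K(s)$ for some $s$. For $\mathbf b=(b_1,\dots,b_m)\in\{0,\dots,n\}^m$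 put $|\mathbf b|=b_1+\dots+b_m$ and let $s(\mathbf b)$ be the Kauffman state whose $i$-th row (from the top) consists of $b_i$ markers $1$ followed by $n-b_i$ markers $-1$. Let $\mathfrak b(C)=\{\mathbf b : \mathbf K(s(\mathbf b))=C\}$, and let $\mathbf b_{\mathbf M}$ be the lexicographically largest element of $\mathfrak b(C)$. For a Catalan state $C$ without arcs having both ends on the floor, let $T(C)$ be the dual graph of the $m$ arcs of $C$ that have no end on the floor (vertices are the regions into which these arcs divide $\mathrm{R}$, edges are the arcs). It is a tree, rooted at the region $v_0$ adjacent to the floor. A leaf is a vertex $v\ne v_0$ of degree one, and its delay is $f(v)=\max\{1,h(c)\}$, where $c$ is the arc dual to the edge at $v$, $h(c)=0$ if both ends of $c$ are on the ceiling, and otherwise $h(c)$ is the largest index $i$ of an end $y_i$ or $y_i'$ of $c$. **Corollary 4.1.** Let $C$ be a realizable Catalan state with no returns on the floor (no arc with both ends on the floor). Suppose that the rooted tree $T(C)$ is a wedge of $k$ paths with $a_1,\dots,a_k$ edges, joined at one end of each, this common vertex being the root, and that the delay function is trivial, i.e. $f(v)=1$ for every leaf $v$. Then $\mathfrak b(C)\neq\emptyset$,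 so that $\mathbf b_{\mathbf M}$ exists, and $$C(A)=A^{2|\mathbf b_{\mathbf M}|-mn}\binom{a_1+a_2+\dots+a_k}{a_1,a_2,\dots,a_k}_{q=A^{-4}},$$ where $\binom{a_1+\dots+a_k}{a_1,\dots,a_k}_q=\dfrac{[a_1+\dots+a_k]_q!}{[a_1]_q!\cdots[a_k]_q!}\in\mathbb Z[q]$, $[r]_q=1+q+\dots+q^{r-1}$ and $[r]_q!=[1]_q[2]_q\cdots[r]_q$. -/

import Mathlib

open LaurentPolynomial

noncomputable section

namespace LatticeCrossing

/-! ### Boundary points and Catalan states -/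

/-- The `2(m+n)` marked points on the boundary of the rectangle: `x_1, …, x_n` on the ceiling and
`x'_1, …, x'_n` on the floor (numbered from left to right), `y_1, …, y_m` on the left side and
`y'_1, …, y'_m` on the right side (numbered from top to bottom). Indices here start from `0`. -/
inductive BdPt (m n : ℕ) : Type
  | top (j : Fin n)
  | bot (j : Fin n)
  | left (i : Fin m)
  | right (i : Fin m)

/-- The position of a marked point when the boundary is traversed clockwise from the bottom left
corner: up the left side, along the ceiling, down the right side, back along the floor. -/
def BdPt.pos {m n : ℕ} : BdPt m n → ℕ
  | .left i => m - 1 - i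
  | .top j => m + j
  | .right i => m + n + i
  | .bot j => m + n + m + (n - 1 - j)

/-- The point lies on the floor. -/
def BdPt.OnFloor {m n : ℕ} : BdPt m n → Prop
  | .bot _ => True
  | _ => False

/-- A Catalan state: a crossingless connection of the `2(m+n)` marked points by `m+n` arcs in the
rectangle. Up to isotopy it is the pairing `mate` of the marked points, no two pairs of which are
interleaved along the boundary. -/
structure CatalanState (m n : ℕ) where
  mate : BdPt m n → BdPt m n
  mate_mate : ∀ p, mate (mate p) = p
  mate_ne : ∀ p, mate p ≠ p
  noncrossing : ∀ p q,
    ¬ (p.pos < q.pos ∧ q.pos < (mate p).pos ∧ (mate p).pos < (mate q).pos)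

/-- No arc of `C` has both ends on the floor. -/
def CatalanState.NoFloorReturns {m n : ℕ} (C : CatalanState m n) : Prop :=
  ∀ p : BdPt m n, p.OnFloor → ¬ (C.mate p).OnFloor

/-! ### Kauffman states of the lattice crossing -/

/-- A Kauffman state of the lattice crossing with `m` horizontal and `n` vertical lines: a marker
`1` or `-1` at the crossing of the `i`-th row (from the top) and `j`-th column (from the left). -/
abbrev KauffmanState (m n : ℕ) : Type := Matrix (Fin m) (Fin n) ℤˣ

/-- The segments into which the crossings cut the lines: `vert i j` is the segment of the `j`-th
vertical line just above the `i`-th row (below the last row if `i = m`), and `horiz i j` is the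
segment of the `i`-th horizontal line just to the left of the `j`-th column (to the right of the
last column if `j = n`). -/
inductive Seg (m n : ℕ) : Type
  | vert (i : Fin (m + 1)) (j : Fin n)
  | horiz (i : Fin m) (j : Fin (n + 1))

/-- The segment that ends in a given marked point. -/
def BdPt.seg {m n : ℕ} : BdPt m n → Seg m n
  | .top j => .vert 0 j
  | .bot j => .vert (Fin.last m) j
  | .left i => .horiz i 0
  | .right i => .horiz i (Fin.last n)

/-- How the four segments at each crossing are joined after smoothing. The vertical line passes over
the horizontal one, so the positive (`A`-) smoothing joins top with right and left with bottom, and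
the negative one joins top with left and right with bottom. -/
inductive Joined {m n : ℕ} (s : KauffmanState m n) : Seg m n → Seg m n → Prop
  | top_right (i : Fin m) (j : Fin n) (h : s i j = 1) :
      Joined s (.vert i.castSucc j) (.horiz i j.succ)
  | left_bottom (i : Fin m) (j : Fin n) (h : s i j = 1) :
      Joined s (.horiz i j.castSucc) (.vert i.succ j)
  | top_left (i : Fin m) (j : Fin n) (h : s i j = -1) :
      Joined s (.vert i.castSucc j) (.horiz i j.castSucc)
  | right_bottom (i : Fin m) (j : Fin n) (h : s i j = -1) :
      Joined s (.horiz i j.succ) (.vert i.succ j)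

/-- The components of the smoothed diagram `D_s`. -/
def Component {m n : ℕ} (s : KauffmanState m n) : Type :=
  Quotient (Relation.EqvGen.setoid (Joined s))

/-- The component of `D_s` that contains a given segment. -/
def component {m n : ℕ} (s : KauffmanState m n) (e : Seg m n) : Component s :=
  Quotient.mk (Relation.EqvGen.setoid (Joined s)) e

/-- `|D_s|`: the number of closed components of `D_s`, i.e. of those that reach no marked point. -/
def numClosed {m n : ℕ} (s : KauffmanState m n) : ℕ :=
  Nat.card {c : Component s // ∀ p : BdPt m n, component s p.seg ≠ c}

/-- `K(s) = C`: after removal of the closed components of `D_s` the Catalan state `C` remains, that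
is, two distinct marked points are on the same component of `D_s` iff `C` joins them. -/
def Realizes {m n : ℕ} (s : KauffmanState m n) (C : CatalanState m n) : Prop :=
  ∀ p q : BdPt m n, p ≠ q → (component s p.seg = component s q.seg ↔ C.mate p = q)

/-- `C` is realizable: `K⁻¹(C)` is not empty. -/
def CatalanState.Realizable {m n : ℕ} (C : CatalanState m n) : Prop :=
  ∃ s : KauffmanState m n, Realizes s C

/-- `p(s)`, the number of positive markers. -/
def numPos {m n : ℕ} (s : KauffmanState m n) : ℕ :=
  (Finset.univ.filter fun x : Fin m × Fin n => s x.1 x.2 = 1).card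

/-- `n(s)`, the number of negative markers. -/
def numNeg {m n : ℕ} (s : KauffmanState m n) : ℕ :=
  (Finset.univ.filter fun x : Fin m × Fin n => s x.1 x.2 = -1).card

open Classical in
/-- The coefficient `C(A) ∈ ℤ[A, A⁻¹]` of `C` in the Kauffman bracket expansion of the lattice
crossing `L(m,n)`; here `A ^ k` is `T k`. -/
def CatalanState.coeff {m n : ℕ} (C : CatalanState m n) : ℤ[T;T⁻¹] :=
  ∑ s ∈ (Finset.univ : Finset (KauffmanState m n)).filter (fun s => Realizes s C),
    T ((numPos s : ℤ) - (numNeg s : ℤ)) * (-T 2 - T (-2)) ^ numClosed s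

/-! ### Sequences representing a Catalan state -/

/-- The Kauffman state whose `i`-th row consists of `b_i` positive markers followed by `n - b_i`
negative ones. -/
def stateOf {m n : ℕ} (b : Fin m → Fin (n + 1)) : KauffmanState m n :=
  fun i j => if (j : ℕ) < (b i : ℕ) then 1 else -1

/-- The set `𝔟(C)` of the sequences in `{0, …, n}^m` that represent `C`. -/
def CatalanState.seqs {m n : ℕ} (C : CatalanState m n) : Set (Fin m → Fin (n + 1)) :=
  {b | Realizes (stateOf b) C}

/-- `b = b_M`: `b` is the largest element of `𝔟(C)` in the lexicographic order. -/
def CatalanState.IsLexMax {m n : ℕ} (C : CatalanState m n) (b : Fin m → Fin (n + 1)) : Prop :=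
  IsGreatest (toLex '' C.seqs) (toLex b)

/-- The weight `|b| = b_1 + ⋯ + b_m`. -/
def weight {m n : ℕ} (b : Fin m → Fin (n + 1)) : ℕ := ∑ i, (b i : ℕ)

/-! ### The rooted tree with delay function of a Catalan state -/

/-- The arc of `C` that ends in `p` has no end on the floor. -/
def CatalanState.IsUpper {m n : ℕ} (C : CatalanState m n) (p : BdPt m n) : Prop :=
  ¬ p.OnFloor ∧ ¬ (C.mate p).OnFloor

/-- The bottom left corner and the marked points cut the boundary of the rectangle into intervals;
interval number `g` is the one that comes just before position `g` (the last one leads back to the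
corner, along the floor). -/
abbrev BdInterval (m n : ℕ) : Type := Fin (2 * (m + n) + 1)

/-- Remove the arcs with an end on the floor. Two boundary intervals are in the same region of
the rectangle iff none of the remaining arcs separates them. -/
def CatalanState.regionSetoid {m n : ℕ} (C : CatalanState m n) : Setoid (BdInterval m n) where
  r g g' := ∀ p : BdPt m n, C.IsUpper p →
    ((p.pos < (g : ℕ) ∧ (g : ℕ) ≤ (C.mate p).pos) ↔ (p.pos < (g' : ℕ) ∧ (g' : ℕ) ≤ (C.mate p).pos))
  iseqv := ⟨fun _ _ _ => Iff.rfl, fun h p hp => (h p hp).symm,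
    fun h h' p hp => (h p hp).trans (h' p hp)⟩

/-- The regions into which the arcs of `C` without ends on the floor divide the rectangle (each
region is identified with the set of boundary intervals on its boundary). -/
def CatalanState.Region {m n : ℕ} (C : CatalanState m n) : Type := Quotient C.regionSetoid

theorem BdPt.pos_lt {m n : ℕ} (p : BdPt m n) : p.pos < 2 * (m + n) := by
  cases p <;> simp only [BdPt.pos] <;> omega

/-- The region next to the boundary interval just before `p`. -/
def CatalanState.before {m n : ℕ} (C : CatalanState m n) (p : BdPt m n) : C.Region :=
  Quotient.mk C.regionSetoid ⟨p.pos, by have := p.pos_lt; omega⟩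

/-- The region next to the boundary interval just after `p`. -/
def CatalanState.after {m n : ℕ} (C : CatalanState m n) (p : BdPt m n) : C.Region :=
  Quotient.mk C.regionSetoid ⟨p.pos + 1, by have := p.pos_lt; omega⟩

/-- The tree `T(C)`: the dual graph of the arcs of `C` without ends on the floor. Its vertices are
the regions, and two regions are adjacent iff they lie on the two sides of one of these arcs. -/
def CatalanState.tree {m n : ℕ} (C : CatalanState m n) : SimpleGraph C.Region where
  Adj v w := v ≠ w ∧ ∃ p : BdPt m n, C.IsUpper p ∧
    ((v = C.before p ∧ w = C.after p) ∨ (v = C.after p ∧ w = C.before p))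
  symm := ⟨fun _ _ h => ⟨h.1.symm, h.2.imp fun _ hp => ⟨hp.1, hp.2.symm.imp And.symm And.symm⟩⟩⟩
  loopless := ⟨fun _ h => h.1 rfl⟩

/-- The root `v_0` of `T(C)`: the region at the floor. -/
def CatalanState.root {m n : ℕ} (C : CatalanState m n) : C.Region :=
  Quotient.mk C.regionSetoid (Fin.last _)

/-- A leaf: a vertex of degree one other than the root. -/
def CatalanState.IsLeaf {m n : ℕ} (C : CatalanState m n) (v : C.Region) : Prop :=
  v ≠ C.root ∧ (C.tree.neighborSet v).ncard = 1

/-- The index `i` of `y_i` and `y'_i`, and `0` for points on the ceiling and the floor. -/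
def BdPt.level {m n : ℕ} : BdPt m n → ℕ
  | .left i => i + 1
  | .right i => i + 1
  | _ => 0

/-- `h(c)` for the arc `c` that ends in `p`. -/
def CatalanState.height {m n : ℕ} (C : CatalanState m n) (p : BdPt m n) : ℕ :=
  max p.level (C.mate p).level

/-- `IsDelay v d`: the delay function of `T(C)` has the value `d` at the leaf `v`, i.e.
`d = max {1, h(c)}` for the arc `c` dual to the edge at `v`. -/
def CatalanState.IsDelay {m n : ℕ} (C : CatalanState m n) (v : C.Region) (d : ℕ) : Prop :=
  C.IsLeaf v ∧ ∃ p : BdPt m n, C.IsUpper p ∧ (v = C.before p ∨ v = C.after p) ∧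
    d = max 1 (C.height p)

/-- The wedge of `k` paths with `a_1, …, a_k` edges, each attached to the common vertex `none` by
one of its ends; `some ⟨i, j⟩` is the vertex of the `i`-th path at distance `j + 1` from `none`. -/
def wedgeOfPaths {k : ℕ} (a : Fin k → ℕ) : SimpleGraph (Option (Σ i, Fin (a i))) :=
  SimpleGraph.fromRel fun v w => match v, w with
    | none, some y => (y.2 : ℕ) = 0
    | some x, some y => x.1 = y.1 ∧ (y.2 : ℕ) = x.2 + 1
    | _, none => False

/-- `T(C)` with its root and its delay function is the wedge of `k` paths with `a_1, …, a_k` edges,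
rooted at the common vertex and without delays (the delay function is constantly `1`). -/
def CatalanState.TreeIsWedge {m n : ℕ} (C : CatalanState m n) {k : ℕ} (a : Fin k → ℕ) : Prop :=
  (∃ φ : C.tree ≃g wedgeOfPaths a, φ C.root = none) ∧
    ∀ (v : C.Region) (d : ℕ), C.IsDelay v d → d = 1

/-! ### Gaussian multinomial coefficients -/

/-- `[r]_q = 1 + q + ⋯ + q^(r-1)` as a polynomial in `q`. -/
def qInt (r : ℕ) : Polynomial ℤ := ∑ i ∈ Finset.range r, Polynomial.X ^ i

/-- `[r]_q! = [1]_q [2]_q ⋯ [r]_q`. -/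
def qFactorial (r : ℕ) : Polynomial ℤ := ∏ i ∈ Finset.range r, qInt (i + 1)

/-- The `q`-multinomial coefficient `[a_1 + ⋯ + a_k]_q! / ([a_1]_q! ⋯ [a_k]_q!)`. The denominator is
monic and divides the numerator, see `qMultinomial_mul`. -/
def qMultinomial {k : ℕ} (a : Fin k → ℕ) : Polynomial ℤ :=
  qFactorial (∑ i, a i) /ₘ ∏ i, qFactorial (a i)

theorem qFactorial_succ (r : ℕ) : qFactorial (r + 1) = qFactorial r * qInt (r + 1) := by
  simp [qFactorial, Finset.prod_range_succ]

theorem qInt_add (a b : ℕ) : qInt (a + b) = qInt a + Polynomial.X ^ a * qInt b := by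
  simp [qInt, Finset.sum_range_add, Finset.mul_sum, pow_add]

theorem qFactorial_monic (r : ℕ) : (qFactorial r).Monic := by
  refine Polynomial.monic_prod_of_monic _ _ fun i _ => ?_
  exact Polynomial.Monic.geom_sum' Polynomial.monic_X (by simp) (Nat.succ_ne_zero i)

theorem qFactorial_mul_dvd (N : ℕ) : ∀ a b : ℕ, a + b = N →
    qFactorial a * qFactorial b ∣ qFactorial N := by
  induction N with
  | zero =>
    intro a b h
    obtain ⟨rfl, rfl⟩ : a = 0 ∧ b = 0 := by omega
    simp [qFactorial]
  | succ N ih =>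
    intro a b h
    rw [qFactorial_succ, ← h, qInt_add, mul_add]
    refine dvd_add ?_ ?_
    · rcases a with _ | a
      · simp [qInt]
      · obtain ⟨c, hc⟩ := ih a b (by omega)
        rw [hc, qFactorial_succ]
        exact ⟨c, by ring⟩
    · rcases b with _ | b
      · simp [qInt]
      · obtain ⟨c, hc⟩ := ih a b (by omega)
        rw [hc, qFactorial_succ]
        exact ⟨c * Polynomial.X ^ a, by ring⟩

theorem prod_qFactorial_dvd {k : ℕ} (a : Fin k → ℕ) :
    ∏ i, qFactorial (a i) ∣ qFactorial (∑ i, a i) := by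
  induction k with
  | zero => simp
  | succ k ih =>
    rw [Fin.prod_univ_succ, Fin.sum_univ_succ]
    exact (mul_dvd_mul_left _ (ih _)).trans (qFactorial_mul_dvd _ _ _ rfl)

/-- The division in the definition of the `q`-multinomial coefficient is exact. -/
theorem qMultinomial_mul {k : ℕ} (a : Fin k → ℕ) :
    qMultinomial a * ∏ i, qFactorial (a i) = qFactorial (∑ i, a i) := by
  have hm : (∏ i, qFactorial (a i)).Monic :=
    Polynomial.monic_prod_of_monic _ _ fun i _ => qFactorial_monic (a i)
  have h := Polynomial.modByMonic_add_div (qFactorial (∑ i, a i)) (∏ i, qFactorial (a i))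
  rw [(Polynomial.modByMonic_eq_zero_iff_dvd hm).2 (prod_qFactorial_dvd a), zero_add] at h
  rw [qMultinomial, mul_comm]
  exact h

end LatticeCrossing

end

/-! The state sum collapses to a sum over sequences, which then obeys the recursion of the Gaussian
multinomial coefficient.

Call a pair of neighbouring markers `-1, 1` in a row a cup: they connect two neighbouring vertical
segments just below. If the next row does not repeat the cup, its two markers there are `(1,1)`,
`(1,-1)` or `(-1,-1)`. All three give the same Catalan state, and the second closes the cup to a
circle. The contributions are therefore proportional to `A^2`, `-A^2 - A^(-2)` and `A^(-2)`, with
sum zero (`term_add_term_add_term`). Rotating the three choices below the first unrepeated cup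
cancels all states that have one (`sum_isFirstTerminal`). If every cup is repeated, a cup reaches
the last row and gives a return on the floor. Only the states without cups survive; these are the
`stateOf b`. They have no circles, so each contributes a power of `A` fixed by its weight
(`CatalanState.coeff_eq_sum_seqs`).

Unfold the left side, ceiling and right side to an interval of integers. A row with `v` positive
markers joins the strands numbered `v - 1` and `v` and closes the gap. Hence `b` represents `C` iff
every row creates an arc of `C`; the arcs to the floor are then forced by planarity
(`realizes_stateOf_iff`).

If the tree is a wedge of paths, the arcs off the floor are nested families around centres `c i`,
with `a i` arcs each, on pairwise disjoint intervals; trivial delay means `0 ≤ c i ≤ n`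
(`exists_centres`). Counting points gives `∑ a i = m`. A representing sequence thus amounts to a
shuffle: each row adds the next arc around some unfinished centre, and the bounds on `c i` make each
of these moves available at any time. The lexicographic maximum always takes the rightmost
unfinished centre. Serving centre `i` first instead loses twice the number of arcs still missing to
its right, i.e. a factor `q` in `q = A^(-4)` for each of them. This is the recursion
`qMultinomial_rec`, and induction on the number of rows finishes the proof (`seqSum_isStage`). -/

open LaurentPolynomial

noncomputable section

namespace LatticeCrossing

/-! ### Strands running down through the rows -/

/-- Strand number `v - 1` and strand number `v` are joined and the others are renumbered. -/
def stepBars (β : ℤ → ℤ) (v : ℤ) : ℤ → ℤ := fun j => if j < v then β (j - 1) else β (j + 1)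

/-- The origins of the strands below `t` rows of the form `1, …, 1, -1, …, -1`. -/
def bars (β : ℤ → ℤ) (v : ℕ → ℤ) : ℕ → ℤ → ℤ
  | 0 => β
  | t + 1 => stepBars (bars β v t) (v t)

/-- Peels off the first row instead of the last, as needed for induction on sequences built with
`Fin.cons`. -/
theorem bars_succ' (β : ℤ → ℤ) (v : ℕ → ℤ) (t : ℕ) :
    bars β v (t + 1) = bars (stepBars β (v 0)) (fun u => v (u + 1)) t := by
  induction t with
  | zero => rfl
  | succ t ih => rw [bars, ih]; rfl

theorem stepBars_strictMono {β : ℤ → ℤ} (hβ : StrictMono β) (v : ℤ) :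
    StrictMono (stepBars β v) := by
  intro i j hij
  simp only [stepBars]
  split_ifs <;> first | omega | (apply hβ; omega)

theorem mem_range_stepBars {β : ℤ → ℤ} (v y : ℤ) (hy : y ∈ Set.range β) :
    y ∈ Set.range (stepBars β v) ∨ y = β (v - 1) ∨ y = β v := by
  obtain ⟨j, rfl⟩ := hy
  by_cases h1 : j < v - 1
  · refine Or.inl ⟨j + 1, ?_⟩
    simp [stepBars, show j + 1 < v by omega]
  · by_cases h2 : v < j
    · refine Or.inl ⟨j - 1, ?_⟩
      simp [stepBars, show ¬ (j - 1 < v) by omega]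
    · right
      obtain rfl | rfl : j = v - 1 ∨ j = v := by omega
      · exact Or.inl rfl
      · exact Or.inr rfl

theorem bars_strictMono (v : ℕ → ℤ) (t : ℕ) : StrictMono (bars id v t) := by
  induction t with
  | zero => exact strictMono_id
  | succ t ih => exact stepBars_strictMono ih _

/-- Strands outside the columns are only shifted, by one in each row. The numbers `-1` and `n`
therefore belong to the left and right marked points of the current row, so one bi-infinite sequence
of strands serves for the sides as well. -/
theorem bars_of_neg {v : ℕ → ℤ} (hv : ∀ t, 0 ≤ v t) (t : ℕ) (j : ℤ) (hj : j < 0) :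
    bars id v t j = j - t := by
  induction t generalizing j with
  | zero => simp [bars]
  | succ t ih =>
    have := hv t
    rw [bars, stepBars, if_pos (by omega), ih _ (by omega)]
    push_cast; ring

theorem bars_of_ge {v : ℕ → ℤ} {n : ℤ} (hv : ∀ t, v t ≤ n) (t : ℕ) (j : ℤ) (hj : n ≤ j) :
    bars id v t j = j + t := by
  induction t generalizing j with
  | zero => simp [bars]
  | succ t ih =>
    have := hv t
    rw [bars, stepBars, if_neg (by omega), ih _ (by omega)]
    push_cast; ring

variable {m n : ℕ}

/-- A sequence of row values, continued by zeros. -/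
def rowVal (b : Fin m → Fin (n + 1)) (t : ℕ) : ℤ := if h : t < m then ((b ⟨t, h⟩ : ℕ) : ℤ) else 0

theorem rowVal_fin (b : Fin m → Fin (n + 1)) (t : Fin m) : rowVal b t = ((b t : ℕ) : ℤ) := by
  simp [rowVal]

theorem rowVal_nonneg (b : Fin m → Fin (n + 1)) (t : ℕ) : 0 ≤ rowVal b t := by
  unfold rowVal; split_ifs <;> omega

theorem rowVal_le (b : Fin m → Fin (n + 1)) (t : ℕ) : rowVal b t ≤ n := by
  unfold rowVal; split_ifs with h <;> omega

theorem rowVal_cons (v : Fin (n + 1)) (b : Fin m → Fin (n + 1)) (t : ℕ) :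
    rowVal (Fin.cons v b : Fin (m + 1) → Fin (n + 1)) (t + 1) = rowVal b t := by
  unfold rowVal
  by_cases h : t < m
  · rw [dif_pos h, dif_pos (Nat.succ_lt_succ h)]
    rw [show (⟨t + 1, Nat.succ_lt_succ h⟩ : Fin (m + 1)) = Fin.succ ⟨t, h⟩ from rfl, Fin.cons_succ]
  · rw [dif_neg h, dif_neg (by omega)]

/-- The origins of the strands below the first `t` rows of `stateOf b`. -/
abbrev strands (b : Fin m → Fin (n + 1)) (t : ℕ) : ℤ → ℤ := bars id (rowVal b) t

/-! ### Integer coordinates of the marked points -/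

/-- The coordinate on the unfolded upper boundary, with `0, …, n - 1` the points of the ceiling. -/
def BdPt.coord (p : BdPt m n) : ℤ := (p.pos : ℤ) - m

theorem BdPt.pos_injective : Function.Injective (BdPt.pos : BdPt m n → ℕ) := by
  intro p q h
  cases p <;> cases q <;> simp only [BdPt.pos] at h <;> first | omega | (congr 1; ext; omega)

theorem BdPt.coord_injective : Function.Injective (BdPt.coord : BdPt m n → ℤ) := by
  intro p q h
  apply BdPt.pos_injective
  simp only [BdPt.coord] at h
  omega

theorem BdPt.coord_top (j : Fin n) : (BdPt.top j : BdPt m n).coord = j := by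
  simp [BdPt.coord, BdPt.pos]

theorem BdPt.coord_left (i : Fin m) : (BdPt.left i : BdPt m n).coord = -1 - i := by
  simp only [BdPt.coord, BdPt.pos]; omega

theorem BdPt.coord_right (i : Fin m) : (BdPt.right i : BdPt m n).coord = n + i := by
  simp only [BdPt.coord, BdPt.pos]; omega

theorem BdPt.coord_bot (j : Fin n) :
    (BdPt.bot j : BdPt m n).coord = n + m + (n - 1 - j) := by
  simp only [BdPt.coord, BdPt.pos]; omega

theorem BdPt.onFloor_iff (p : BdPt m n) : p.OnFloor ↔ (n : ℤ) + m ≤ p.coord := by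
  cases p <;> simp only [BdPt.OnFloor, coord_top, coord_left, coord_right, coord_bot, true_iff,
    false_iff] <;> omega

theorem BdPt.neg_le_coord (p : BdPt m n) : -(m : ℤ) ≤ p.coord := by
  simp only [BdPt.coord]; omega

theorem BdPt.exists_coord {x : ℤ} (h1 : -(m : ℤ) ≤ x) (h2 : x < n + m) :
    ∃ p : BdPt m n, p.coord = x ∧ ¬ p.OnFloor := by
  by_cases h3 : x < 0
  · exact ⟨.left ⟨(-1 - x).toNat, by omega⟩, by rw [coord_left]; simp only; omega, id⟩
  · by_cases h4 : x < n
    · exact ⟨.top ⟨x.toNat, by omega⟩, by rw [coord_top]; simp only; omega, id⟩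
    · exact ⟨.right ⟨(x - n).toNat, by omega⟩, by rw [coord_right]; simp only; omega, id⟩

/-- `C` has an arc without ends on the floor that joins the points with coordinates `x` and `y`. -/
def CatalanState.Arc (C : CatalanState m n) (x y : ℤ) : Prop :=
  ∃ p : BdPt m n, C.IsUpper p ∧ p.coord = x ∧ (C.mate p).coord = y

/-! ### Components of the diagrams of sequences -/

theorem component_eq_of_joined {s : KauffmanState m n} {x y : Seg m n} (h : Joined s x y) :
    component s x = component s y :=
  Quotient.sound (Relation.EqvGen.rel _ _ h)

theorem component_eq_iff {s : KauffmanState m n} {x y : Seg m n} :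
    component s x = component s y ↔ Relation.EqvGen (Joined s) x y :=
  Quotient.eq (r := Relation.EqvGen.setoid (Joined s))

theorem stateOf_of_lt {b : Fin m → Fin (n + 1)} {i : Fin m} {j : Fin n} (h : (j : ℕ) < b i) :
    stateOf b i j = 1 := if_pos h

theorem stateOf_of_le {b : Fin m → Fin (n + 1)} {i : Fin m} {j : Fin n} (h : (b i : ℕ) ≤ j) :
    stateOf b i j = -1 := if_neg (by omega)

/-- The coordinate of the upper boundary point from which a segment of `stateOf b` descends. -/
def segLabel (b : Fin m → Fin (n + 1)) : Seg m n → ℤ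
  | .vert t j => strands b t j
  | .horiz t j => if (j : ℕ) ≤ b t then strands b t (j - 1) else strands b t j

theorem strands_succ_of_lt {b : Fin m → Fin (n + 1)} {t : Fin m} {j : ℕ} (h : j < (b t : ℕ)) :
    strands b (t + 1) j = strands b t (j - 1) := by
  show stepBars _ _ _ = _
  rw [stepBars, rowVal_fin, if_pos (by omega)]

theorem strands_succ_of_le {b : Fin m → Fin (n + 1)} {t : Fin m} {j : ℕ} (h : (b t : ℕ) ≤ j) :
    strands b (t + 1) j = strands b t (j + 1) := by
  show stepBars _ _ _ = _
  rw [stepBars, rowVal_fin, if_neg (by omega)]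

theorem strands_neg_one (b : Fin m → Fin (n + 1)) (t : ℕ) : strands b t (-1) = -1 - t :=
  bars_of_neg (rowVal_nonneg b) _ _ (by omega)

theorem strands_card (b : Fin m → Fin (n + 1)) (t : ℕ) : strands b t n = n + t :=
  bars_of_ge (rowVal_le b) _ _ le_rfl

/-- A horizontal segment to the right of a positive marker continues the vertical segment above that
marker; the leftmost one starts at the side. -/
theorem component_horiz_of_le {b : Fin m → Fin (n + 1)} {t : Fin m}
    (hV : ∀ (j : Fin n) (p : BdPt m n), p.coord = strands b t j →
      component (stateOf b) (.vert t.castSucc j) = component (stateOf b) p.seg)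
    (j : Fin (n + 1)) (hj : (j : ℕ) ≤ b t) (p : BdPt m n) (hp : p.coord = strands b t (j - 1)) :
    component (stateOf b) (.horiz t j) = component (stateOf b) p.seg := by
  rcases Nat.eq_zero_or_pos (j : ℕ) with h0 | h0
  · have hj0 : j = 0 := Fin.ext h0
    subst hj0
    have : p = .left t := BdPt.coord_injective (by
      rw [hp, BdPt.coord_left]; simpa using strands_neg_one b t)
    subst this
    rfl
  · have hjn : (j : ℕ) - 1 < n := by omega
    have h := component_eq_of_joined
      (Joined.top_right (s := stateOf b) t ⟨j - 1, hjn⟩ (stateOf_of_lt (by simp only; omega)))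
    have hs : (⟨(j : ℕ) - 1, hjn⟩ : Fin n).succ = j := Fin.ext (by simp; omega)
    rw [hs] at h
    rw [← h]
    refine hV _ p ?_
    rw [hp]
    congr 1
    simp only
    omega

theorem component_horiz_of_ge {b : Fin m → Fin (n + 1)} {t : Fin m}
    (hV : ∀ (j : Fin n) (p : BdPt m n), p.coord = strands b t j →
      component (stateOf b) (.vert t.castSucc j) = component (stateOf b) p.seg)
    (j : Fin (n + 1)) (hj : (b t : ℕ) ≤ j) (p : BdPt m n) (hp : p.coord = strands b t j) :
    component (stateOf b) (.horiz t j) = component (stateOf b) p.seg := by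
  rcases Nat.lt_or_ge (j : ℕ) n with h0 | h0
  · have h := component_eq_of_joined
      (Joined.top_left (s := stateOf b) t ⟨j, h0⟩ (stateOf_of_le hj))
    have hs : (⟨(j : ℕ), h0⟩ : Fin n).castSucc = j := rfl
    rw [hs] at h
    rw [← h]
    exact hV _ p hp
  · have hj0 : j = Fin.last n := Fin.ext (by simp; omega)
    subst hj0
    have : p = .right t := BdPt.coord_injective (by
      rw [hp, BdPt.coord_right]; simpa using strands_card b t)
    subst this
    rfl

theorem component_vert (b : Fin m → Fin (n + 1)) (t : ℕ) (ht : t < m + 1) (j : Fin n)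
    (p : BdPt m n) (hp : p.coord = strands b t j) :
    component (stateOf b) (.vert ⟨t, ht⟩ j) = component (stateOf b) p.seg := by
  induction t generalizing j p with
  | zero =>
    have : p = .top j := BdPt.coord_injective (by rw [hp, BdPt.coord_top]; rfl)
    subst this
    rfl
  | succ t ih =>
    have htm : t < m := by omega
    have hV := ih (by omega)
    rcases Nat.lt_or_ge (j : ℕ) (b ⟨t, htm⟩) with h | h
    · have hj := component_eq_of_joined
        (Joined.left_bottom (s := stateOf b) ⟨t, htm⟩ j (stateOf_of_lt h))
      refine hj.symm.trans (component_horiz_of_le hV _ (by simpa using h.le) p ?_)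
      rw [hp]
      exact strands_succ_of_lt (t := ⟨t, htm⟩) h
    · have hj := component_eq_of_joined
        (Joined.right_bottom (s := stateOf b) ⟨t, htm⟩ j (stateOf_of_le h))
      refine hj.symm.trans (component_horiz_of_ge hV _ (by simp; omega) p ?_)
      rw [hp]
      simpa using strands_succ_of_le (t := ⟨t, htm⟩) h

/-- The horizontal segment number `b t` lies between the positive and the negative markers, so it is
reached by the strands on both of its sides. -/
theorem component_arc (b : Fin m → Fin (n + 1)) (t : Fin m) (p q : BdPt m n)
    (hp : p.coord = strands b t (b t - 1)) (hq : q.coord = strands b t (b t)) :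
    component (stateOf b) p.seg = component (stateOf b) q.seg := by
  have hV := component_vert b t (by omega)
  rw [← component_horiz_of_le hV (b t) le_rfl p hp]
  exact component_horiz_of_ge hV (b t) le_rfl q hq

theorem strands_mem_window (b : Fin m → Fin (n + 1)) (t : ℕ) {j : ℤ}
    (h0 : -1 ≤ j) (hn : j ≤ n) :
    -1 - (t : ℤ) ≤ strands b t j ∧ strands b t j ≤ n + t := by
  have hm := (bars_strictMono (rowVal b) t).monotone
  exact ⟨(strands_neg_one b t).symm.le.trans (hm h0), (hm hn).trans (strands_card b t).le⟩

theorem strands_mem_window' (b : Fin m → Fin (n + 1)) (t : ℕ) {j : ℤ}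
    (h0 : 0 ≤ j) (hn : j < n) :
    -(t : ℤ) ≤ strands b t j ∧ strands b t j < n + t := by
  have hm := (bars_strictMono (rowVal b) t)
  have h1 := hm (show (-1 : ℤ) < j by omega)
  have h2 := hm hn
  have h3 := strands_neg_one b t
  have h4 := strands_card b t
  simp only [strands] at *
  omega

theorem exists_point_of_strand (b : Fin m → Fin (n + 1)) (t : Fin m) {j : ℤ}
    (h0 : -1 ≤ j) (hn : j ≤ n) :
    ∃ p : BdPt m n, p.coord = strands b t j ∧ ¬ p.OnFloor := by
  have h := strands_mem_window b t h0 hn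
  have := t.2
  exact BdPt.exists_coord (by omega) (by omega)

/-- Every segment of the diagram of a sequence reaches the boundary. -/
theorem exists_point_component (b : Fin m → Fin (n + 1)) (x : Seg m n) :
    ∃ p : BdPt m n, component (stateOf b) p.seg = component (stateOf b) x := by
  rcases x with ⟨t, j⟩ | ⟨t, j⟩
  · have h := strands_mem_window' b t (j := (j : ℕ)) (by omega) (by omega)
    obtain ⟨p, hp, -⟩ := BdPt.exists_coord (m := m) (n := n) (x := strands b t (j : ℕ))
      (by omega) (by omega)
    exact ⟨p, (component_vert b t t.2 j p hp).symm⟩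
  · have hV := component_vert b t (by omega)
    rcases Nat.le_total (j : ℕ) (b t) with h | h
    · obtain ⟨p, hp, -⟩ := exists_point_of_strand b t (j := (j : ℤ) - 1) (by omega) (by omega)
      exact ⟨p, (component_horiz_of_le hV j h p hp).symm⟩
    · obtain ⟨p, hp, -⟩ := exists_point_of_strand b t (j := (j : ℤ)) (by omega) (by omega)
      exact ⟨p, (component_horiz_of_ge hV j h p hp).symm⟩

theorem numClosed_stateOf (b : Fin m → Fin (n + 1)) : numClosed (stateOf b) = 0 := by
  rw [numClosed, Nat.card_eq_zero]
  left
  refine ⟨fun ⟨c, hc⟩ => ?_⟩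
  obtain ⟨x, rfl⟩ := Quotient.exists_rep c
  obtain ⟨p, hp⟩ := exists_point_component b x
  exact hc p hp

/-- The arcs created by the rows of a sequence, when the strands start at `β`, all satisfy `R`. -/
def GoodSeq (R : ℤ → ℤ → Prop) (β : ℤ → ℤ) (b : Fin m → Fin (n + 1)) : Prop :=
  ∀ t : Fin m, R (bars β (rowVal b) t (b t - 1)) (bars β (rowVal b) t (b t))

theorem goodSeq_cons {R : ℤ → ℤ → Prop} {β : ℤ → ℤ} {v : Fin (n + 1)}
    {b : Fin m → Fin (n + 1)} :
    GoodSeq R β (Fin.cons v b : Fin (m + 1) → Fin (n + 1)) ↔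
      R (β (v - 1)) (β v) ∧ GoodSeq R (stepBars β v) b := by
  rw [GoodSeq, Fin.forall_fin_succ]
  refine and_congr (by simp [bars]) (forall_congr' fun t => ?_)
  have : bars β (rowVal (Fin.cons v b : Fin (m + 1) → Fin (n + 1))) (t + 1)
      = bars (stepBars β v) (rowVal b) t := by
    rw [bars_succ']
    congr 1
    exact funext fun u => rowVal_cons v b u
  simp [this]

/-- A strand either continues below row `k` or was used up as one of the two strands joined in some
row. -/
theorem mem_range_strands (b : Fin m → Fin (n + 1)) (x : ℤ) (k : ℕ) (hk : k ≤ m) :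
    x ∈ Set.range (strands b k) ∨
      ∃ t : Fin m, x = strands b t (b t - 1) ∨ x = strands b t (b t) := by
  induction k with
  | zero => exact Or.inl ⟨x, rfl⟩
  | succ k ih =>
    rcases ih (by omega) with h | h
    · rcases mem_range_stepBars (rowVal b k) x h with h | h
      · exact Or.inl h
      · refine Or.inr ⟨⟨k, hk⟩, ?_⟩
        rw [← rowVal_fin b ⟨k, hk⟩]
        exact h
    · exact Or.inr h

theorem CatalanState.Arc.mate_eq {C : CatalanState m n} {p q : BdPt m n} {x y : ℤ}
    (h : C.Arc x y) (hp : p.coord = x) (hq : q.coord = y) : C.mate p = q ∧ C.IsUpper p := by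
  obtain ⟨p', hu, h1, h2⟩ := h
  obtain rfl : p' = p := BdPt.coord_injective (h1.trans hp.symm)
  exact ⟨BdPt.coord_injective (h2.trans hq.symm), hu⟩

theorem CatalanState.IsUpper.mate {C : CatalanState m n} {p : BdPt m n} (h : C.IsUpper p) :
    C.IsUpper (C.mate p) := ⟨h.2, by rw [C.mate_mate]; exact h.1⟩

theorem CatalanState.Arc.symm {C : CatalanState m n} {x y : ℤ} (h : C.Arc x y) : C.Arc y x := by
  obtain ⟨p, hu, h1, h2⟩ := h
  exact ⟨C.mate p, hu.mate, h2, by rw [C.mate_mate]; exact h1⟩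

/-- The floor points are joined to the strands that remain below the last row. -/
theorem mate_bot_of_goodSeq {C : CatalanState m n} (hF : C.NoFloorReturns)
    {b : Fin m → Fin (n + 1)} (hb : GoodSeq C.Arc id b) (j : Fin n) :
    (C.mate (.bot j)).coord = strands b m j := by
  have key : ∀ j : Fin n, ∃ i : Fin n, (C.mate (.bot j)).coord = strands b m i := by
    intro j
    have hnf := hF (.bot j) trivial
    rcases mem_range_strands b (C.mate (.bot j)).coord m le_rfl with ⟨i, hi⟩ | ⟨t, ht⟩
    · have h1 := (C.mate (.bot j)).neg_le_coord
      have h2 := mt (BdPt.onFloor_iff _).2 hnf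
      have hm := bars_strictMono (rowVal b) m
      have h3 : (-1 : ℤ) < i := hm.lt_iff_lt.1 (by
        have := strands_neg_one b m
        simp only [strands] at *; omega)
      have h4 : i < n := hm.lt_iff_lt.1 (by
        have := strands_card b m
        simp only [strands] at *; omega)
      refine ⟨⟨i.toNat, by omega⟩, ?_⟩
      rw [← hi]
      congr 1
      simp only
      omega
    · exfalso
      have hu : ∀ y z, C.Arc y z → (C.mate (.bot j)).coord = y → False := by
        rintro y z ⟨p, hu, h1, h2⟩ h
        obtain rfl : p = C.mate (.bot j) := BdPt.coord_injective (h1.trans h.symm)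
        apply hu.2
        rw [C.mate_mate]
        trivial
      rcases ht with ht | ht
      · exact hu _ _ (hb t) ht
      · exact hu _ _ (hb t).symm ht
  choose σ hσ using key
  -- Coordinates on the floor decrease from left to right, so two floor points whose partners come
  -- in the wrong order would belong to crossing arcs. A strictly increasing self-map of `Fin n` is
  -- the identity.
  have hmono : StrictMono σ := by
    intro i j hij
    have hm := bars_strictMono (rowVal b) m
    by_contra hcon
    have hne : (C.mate (.bot i)).coord ≠ (C.mate (.bot j)).coord := by
      intro h
      have := congrArg C.mate (BdPt.coord_injective h)
      rw [C.mate_mate, C.mate_mate] at this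
      injection this with this
      exact hij.ne this
    have hle : (C.mate (.bot j)).coord ≤ (C.mate (.bot i)).coord := by
      rw [hσ, hσ]
      exact hm.monotone (by have := Fin.not_lt.1 hcon; omega)
    have h1 := mt (BdPt.onFloor_iff _).2 (hF (.bot i) trivial)
    have h2 := mt (BdPt.onFloor_iff _).2 (hF (.bot j) trivial)
    refine C.noncrossing (C.mate (.bot j)) (C.mate (.bot i)) ?_
    rw [C.mate_mate, C.mate_mate]
    have h3 := BdPt.coord_bot (m := m) i
    have h4 := BdPt.coord_bot (m := m) j
    simp only [BdPt.coord] at *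
    omega
  have hid : σ = id := by
    have h1 := hmono.id_le
    funext i
    have h2 := hmono.le_id
    exact le_antisymm (h2 i) (h1 i)
  rw [hσ, hid]
  rfl

theorem mem_pair_iff_of_arc {C : CatalanState m n} {x y : ℤ} (h : C.Arc x y) (p : BdPt m n) :
    (p.coord = x ∨ (C.mate p).coord = x) ↔ (p.coord = y ∨ (C.mate p).coord = y) := by
  obtain ⟨q, -, rfl, rfl⟩ := h
  simp only [BdPt.coord_injective.eq_iff]
  constructor
  · rintro (rfl | rfl)
    · exact Or.inr rfl
    · exact Or.inl (C.mate_mate p).symm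
  · rintro (rfl | h)
    · exact Or.inr (C.mate_mate q)
    · left
      rw [← C.mate_mate p, h, C.mate_mate]

/-- The label itself is not constant on components: at the horizontal segment `b t` it jumps from
one joined strand to the other. What stays constant is the arc of `C` containing the labelled point,
because the jump runs along an arc. -/
theorem mem_pair_iff_of_joined {C : CatalanState m n} {b : Fin m → Fin (n + 1)}
    (hb : GoodSeq C.Arc id b) {x y : Seg m n} (h : Joined (stateOf b) x y) (p : BdPt m n) :
    (p.coord = segLabel b x ∨ (C.mate p).coord = segLabel b x) ↔
      (p.coord = segLabel b y ∨ (C.mate p).coord = segLabel b y) := by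
  have hlt : ∀ i j, stateOf b i j = 1 → (j : ℕ) < b i := fun i j h => by
    by_contra hc
    rw [stateOf_of_le (by omega)] at h
    exact absurd h (by decide)
  have hge : ∀ i j, stateOf b i j = -1 → (b i : ℕ) ≤ j := fun i j h => by
    by_contra hc
    rw [stateOf_of_lt (by omega)] at h
    exact absurd h (by decide)
  cases h with
  | top_right i j h =>
    have := hlt i j h
    simp [segLabel, Nat.succ_le_iff.2 this]
  | left_bottom i j h =>
    have := hlt i j h
    have hs := strands_succ_of_lt this
    simp only [segLabel, Fin.val_castSucc, this.le, if_true, Fin.val_succ, hs]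
  | top_left i j h =>
    have := hge i j h
    rcases this.lt_or_eq with h' | h'
    · simp [segLabel, Nat.not_le.2 h']
    · have ha := hb i
      simp only [segLabel, Fin.val_castSucc, h', le_refl, if_true]
      rw [← h']
      exact (mem_pair_iff_of_arc ha p).symm
  | right_bottom i j h =>
    have := hge i j h
    have hs := strands_succ_of_le this
    simp only [segLabel, Fin.val_succ, show ¬ ((j : ℕ) + 1 ≤ b i) by omega, if_false, hs]
    push_cast
    rfl

/-- The label of a marked point is its own coordinate except in two cases, where it is that of its
partner: for floor points, and for a right end of a row consisting of positive markers only. -/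
theorem mem_pair_seg {C : CatalanState m n} (hF : C.NoFloorReturns) {b : Fin m → Fin (n + 1)}
    (hb : GoodSeq C.Arc id b) (p q : BdPt m n) :
    (q.coord = segLabel b p.seg ∨ (C.mate q).coord = segLabel b p.seg) ↔
      (q = p ∨ C.mate q = p) := by
  have key : ∀ x : ℤ, x = p.coord → ((q.coord = x ∨ (C.mate q).coord = x) ↔
      (q = p ∨ C.mate q = p)) := by
    rintro x rfl
    simp only [BdPt.coord_injective.eq_iff]
  rcases p with j | j | i | i
  · exact key _ (by rw [BdPt.coord_top]; rfl)
  · have h : segLabel b (BdPt.bot j).seg = (C.mate (.bot j)).coord := by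
      rw [mate_bot_of_goodSeq hF hb]; rfl
    rw [h]
    simp only [BdPt.coord_injective.eq_iff]
    constructor
    · rintro (rfl | h)
      · exact Or.inr (C.mate_mate _)
      · left; rw [← C.mate_mate q, h, C.mate_mate]
    · rintro (rfl | h)
      · exact Or.inr rfl
      · left; rw [← C.mate_mate q, h]
  · refine key _ ?_
    rw [BdPt.coord_left]
    simpa [segLabel, BdPt.seg] using strands_neg_one b i
  · by_cases h : n ≤ (b i : ℕ)
    · have hbn : (b i : ℕ) = n := by omega
      have ha := hb i
      rw [hbn] at ha
      have hl : segLabel b (BdPt.right i).seg = strands b i ((n : ℤ) - 1) := by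
        simp [segLabel, BdPt.seg, hbn]
      rw [hl, mem_pair_iff_of_arc ha]
      exact key _ (by rw [BdPt.coord_right]; exact strands_card b i)
    · refine key _ ?_
      rw [BdPt.coord_right]
      simpa [segLabel, BdPt.seg, h] using strands_card b i

/-- The strands joined in a row are connected in the diagram, so `C` must connect them. Conversely,
once all rows create arcs of `C`, the remaining strands run to the floor points in the only planar
way, and the arc through the label is an invariant that separates the components. -/
theorem realizes_stateOf_iff {C : CatalanState m n} (hF : C.NoFloorReturns)
    (b : Fin m → Fin (n + 1)) : Realizes (stateOf b) C ↔ GoodSeq C.Arc id b := by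
  constructor
  · intro h t
    obtain ⟨p, hp, hpf⟩ := exists_point_of_strand b t (j := (b t : ℤ) - 1) (by omega) (by omega)
    obtain ⟨q, hq, hqf⟩ := exists_point_of_strand b t (j := (b t : ℤ)) (by omega) (by omega)
    have hne : p ≠ q := by
      rintro rfl
      have := (bars_strictMono (rowVal b) t).injective (hp.symm.trans hq)
      omega
    have hm := (h p q hne).1 (component_arc b t p q hp hq)
    refine ⟨p, ⟨hpf, by rw [hm]; exact hqf⟩, hp, by rw [hm]; exact hq⟩
  · intro hb p q hpq
    constructor
    · intro h
      have hinv : ∀ x y, Relation.EqvGen (Joined (stateOf b)) x y → ∀ r : BdPt m n,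
          (r.coord = segLabel b x ∨ (C.mate r).coord = segLabel b x) ↔
            (r.coord = segLabel b y ∨ (C.mate r).coord = segLabel b y) := by
        intro x y hxy
        induction hxy with
        | rel x y h => exact mem_pair_iff_of_joined hb h
        | refl => exact fun _ => Iff.rfl
        | symm x y _ ih => exact fun r => (ih r).symm
        | trans x y z _ _ ih ih' => exact fun r => (ih r).trans (ih' r)
      have h1 := hinv _ _ (component_eq_iff.1 h) p
      rw [mem_pair_seg hF hb, mem_pair_seg hF hb] at h1
      exact (h1.1 (Or.inl rfl)).resolve_left hpq
    · intro h
      have hbot : ∀ (j : Fin n) (q : BdPt m n), C.mate (.bot j) = q →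
          component (stateOf b) (BdPt.bot j).seg = component (stateOf b) q.seg := by
        rintro j q rfl
        exact component_vert b m (by omega) j _ (mate_bot_of_goodSeq hF hb j)
      by_cases hpf : p.OnFloor
      · rcases p with j | j | i | i
        · exact hpf.elim
        · exact hbot j q h
        · exact hpf.elim
        · exact hpf.elim
      by_cases hqf : q.OnFloor
      · rcases q with j | j | i | i
        · exact hqf.elim
        · exact (hbot j p (by rw [← h, C.mate_mate])).symm
        · exact hqf.elim
        · exact hqf.elim
      rcases mem_range_strands b p.coord m le_rfl with ⟨i, hi⟩ | ⟨t, ht | ht⟩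
      · exfalso
        have h1 := p.neg_le_coord
        have h2 := mt (BdPt.onFloor_iff _).2 hpf
        have hm := bars_strictMono (rowVal b) m
        have h3 : (-1 : ℤ) < i := hm.lt_iff_lt.1 (by
          have := strands_neg_one b m
          simp only [strands] at *; omega)
        have h4 : i < n := hm.lt_iff_lt.1 (by
          have := strands_card b m
          simp only [strands] at *; omega)
        obtain ⟨k, rfl⟩ := Int.eq_ofNat_of_zero_le (show 0 ≤ i by omega)
        have h5 := mate_bot_of_goodSeq hF hb ⟨k, by omega⟩
        have h6 : C.mate (.bot ⟨k, by omega⟩) = p := BdPt.coord_injective (h5.trans hi)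
        apply hqf
        rw [← h, ← h6, C.mate_mate]
        trivial
      · obtain ⟨q', hq, -⟩ := exists_point_of_strand b t (j := (b t : ℤ)) (by omega) (by omega)
        obtain ⟨h1, -⟩ := (hb t).mate_eq ht hq
        rw [← h, h1]
        exact component_arc b t p q' ht hq
      · obtain ⟨q', hq, -⟩ := exists_point_of_strand b t (j := (b t : ℤ) - 1) (by omega) (by omega)
        obtain ⟨h1, -⟩ := (hb t).symm.mate_eq ht hq
        rw [← h, h1]
        exact (component_arc b t q' p hq ht).symm

/-! ### Removing a closed component -/

instance : Finite (Seg m n) := by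
  refine Finite.of_injective
    (fun x : Seg m n => match x with
      | .vert i j => (Sum.inl (i, j) : (Fin (m + 1) × Fin n) ⊕ (Fin m × Fin (n + 1)))
      | .horiz i j => Sum.inr (i, j)) ?_
  rintro (⟨i, j⟩ | ⟨i, j⟩) (⟨i', j'⟩ | ⟨i', j'⟩) h <;> simp_all

instance (s : KauffmanState m n) : Finite (Component s) :=
  inferInstanceAs (Finite (Quotient (Relation.EqvGen.setoid (Joined s))))

theorem component_congr {s : KauffmanState m n} {α : Sort*} (g : Seg m n → α)
    (hg : ∀ x y, Joined s x y → g x = g y) {x y : Seg m n}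
    (h : component s x = component s y) : g x = g y := by
  rw [component_eq_iff] at h
  induction h with
  | rel x y h => exact hg x y h
  | refl => rfl
  | symm x y _ ih => exact ih.symm
  | trans x y z _ _ ih ih' => exact ih.trans ih'

/-- If the component of `x₀` in `D_s₂` is `F`, and the diagram `D_s₁` arises by inserting `F` into
another component, then `D_s₂` has one closed component more than `D_s₁`. -/
theorem component_collapse {s₁ s₂ : KauffmanState m n} (F : Seg m n → Prop)
    (f : Seg m n → Seg m n) (hf : ∀ x, ¬ F x → f x = x) (hfF : ∀ x, ¬ F (f x))
    (hB : ∀ p : BdPt m n, ¬ F p.seg)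
    (h₁₂ : ∀ x y, Joined s₁ x y → component s₂ (f x) = component s₂ (f y))
    (h₂₁ : ∀ x y, Joined s₂ x y → component s₁ x = component s₁ y)
    (h₁f : ∀ x, component s₁ x = component s₁ (f x))
    (hF : ∀ x y, Joined s₂ x y → (F x ↔ F y)) (x₀ : Seg m n) (hx₀ : F x₀)
    (hFx₀ : ∀ x, F x → component s₂ x = component s₂ x₀) :
    (∀ C, Realizes s₁ C ↔ Realizes s₂ C) ∧ numClosed s₂ = numClosed s₁ + 1 := by
  have to₂ : ∀ x y, component s₁ x = component s₁ y → component s₂ (f x) = component s₂ (f y) :=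
    fun x y => component_congr (fun x => component s₂ (f x)) h₁₂
  have to₁ : ∀ x y, component s₂ x = component s₂ y → component s₁ x = component s₁ y :=
    fun x y => component_congr (fun x => component s₁ x) h₂₁
  have hFc : ∀ x y, component s₂ x = component s₂ y → (F x ↔ F y) := fun x y h =>
    iff_of_eq (component_congr F (fun x y h => propext (hF x y h)) h)
  constructor
  · intro C
    refine forall_congr' fun p => forall_congr' fun q => forall_congr' fun _ => ?_
    have : component s₁ p.seg = component s₁ q.seg ↔ component s₂ p.seg = component s₂ q.seg :=
      ⟨fun h => by simpa only [hf _ (hB _)] using to₂ _ _ h, to₁ _ _⟩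
    rw [this]
  · rw [numClosed, numClosed, ← Finite.card_option]
    symm
    let g : Component s₁ → Component s₂ :=
      Quotient.lift (fun x => component s₂ (f x))
        (fun x y h => to₂ x y (Quotient.sound h))
    have hg : ∀ x, g (component s₁ x) = component s₂ (f x) := fun _ => rfl
    have hgB : ∀ c : Component s₁, (∀ p : BdPt m n, component s₁ p.seg ≠ c) →
        ∀ p : BdPt m n, component s₂ p.seg ≠ g c := by
      intro c hc p h
      obtain ⟨x, rfl⟩ := Quotient.exists_rep c
      exact hc p ((to₁ _ _ h).trans (h₁f x).symm)
    -- The extra element `none` stands for the component of `x₀`, which the second diagram has split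
    -- off.
    refine Nat.card_congr (Equiv.ofBijective (fun o => match o with
      | none => ⟨component s₂ x₀, fun p h => hB p ((hFc _ _ h).2 hx₀)⟩
      | some c => ⟨g c.1, hgB c.1 c.2⟩) ⟨?_, ?_⟩)
    · rintro (_ | ⟨c, hc⟩) (_ | ⟨c', hc'⟩) h
      · rfl
      · exfalso
        obtain ⟨x, rfl⟩ := Quotient.exists_rep c'
        exact hfF x ((hFc _ _ (congrArg Subtype.val h)).1 hx₀)
      · exfalso
        obtain ⟨x, rfl⟩ := Quotient.exists_rep c
        exact hfF x ((hFc _ _ (congrArg Subtype.val h)).2 hx₀)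
      · obtain ⟨x, rfl⟩ := Quotient.exists_rep c
        obtain ⟨y, rfl⟩ := Quotient.exists_rep c'
        have h' : component s₂ (f x) = component s₂ (f y) := congrArg Subtype.val h
        have h'' := to₁ _ _ h'
        rw [← h₁f, ← h₁f] at h''
        congr 1
        exact Subtype.ext h''
    · rintro ⟨c, hc⟩
      obtain ⟨x, rfl⟩ := Quotient.exists_rep c
      by_cases hx : F x
      · exact ⟨none, Subtype.ext (hFx₀ x hx).symm⟩
      · refine ⟨some ⟨component s₁ x, fun p h => hc p ?_⟩, Subtype.ext ?_⟩
        · have := to₂ _ _ h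
          rwa [hf _ hx, hf _ (hB p)] at this
        · show component s₂ (f x) = component s₂ x
          rw [hf _ hx]

/-! ### The three smoothings below a cup -/

/-- Change the markers in row `r`, columns `i` and `i'`. -/
def setPair (s : KauffmanState m n) (r : Fin m) (i i' : Fin n) (x y : ℤˣ) : KauffmanState m n :=
  fun a j => if a = r ∧ j = i then x else if a = r ∧ j = i' then y else s a j

/-- A cup in row `r` and columns `i`, `i'`, followed by row `r'`. -/
structure IsCup (s : KauffmanState m n) (r r' : Fin m) (i i' : Fin n) : Prop where
  row : (r' : ℕ) = r + 1
  col : (i' : ℕ) = i + 1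
  neg : s r i = -1
  pos : s r i' = 1

/-- The segments of the strand through the cup above row `r'` and the segment that this strand
meets in row `r'`. -/
def CupSeg (r r' : Fin m) (i i' : Fin n) : Seg m n → Prop
  | .vert a j => (a : ℕ) = r' ∧ (j = i ∨ j = i')
  | .horiz a j => (a = r ∨ a = r') ∧ (j : ℕ) = i'

theorem not_cupSeg_seg {r r' : Fin m} {i i' : Fin n} (hr : (r' : ℕ) = r + 1)
    (hi : (i' : ℕ) = i + 1) (p : BdPt m n) : ¬ CupSeg r r' i i' p.seg := by
  rcases p with j | j | a | a <;> simp [BdPt.seg, CupSeg] <;> omega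

section Cup

variable {s : KauffmanState m n} {r r' : Fin m} {i i' : Fin n}

/-- Apart from the eight possible joins at the two changed crossings, a join does not depend on the
new markers and does not leave the strand through the cup. -/
theorem joined_setPair_cases (hc : IsCup s r r' i i') {x y : ℤˣ} {u v : Seg m n}
    (h : Joined (setPair s r' i i' x y) u v) :
    ((CupSeg r r' i i' u ↔ CupSeg r r' i i' v) ∧
      ∀ x' y', Joined (setPair s r' i i' x' y') u v) ∨
    (x = 1 ∧ u = .vert r'.castSucc i ∧ v = .horiz r' i.succ) ∨
    (x = 1 ∧ u = .horiz r' i.castSucc ∧ v = .vert r'.succ i) ∨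
    (x = -1 ∧ u = .vert r'.castSucc i ∧ v = .horiz r' i.castSucc) ∨
    (x = -1 ∧ u = .horiz r' i.succ ∧ v = .vert r'.succ i) ∨
    (y = 1 ∧ u = .vert r'.castSucc i' ∧ v = .horiz r' i'.succ) ∨
    (y = 1 ∧ u = .horiz r' i.succ ∧ v = .vert r'.succ i') ∨
    (y = -1 ∧ u = .vert r'.castSucc i' ∧ v = .horiz r' i.succ) ∨
    (y = -1 ∧ u = .horiz r' i'.succ ∧ v = .vert r'.succ i') := by
  obtain ⟨hr, hi, hn, hp⟩ := hc
  have hne : r ≠ r' := by rintro rfl; omega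
  have hne' : i' ≠ i := by rintro rfl; omega
  have hcs : i'.castSucc = i.succ := Fin.ext (by simp [hi])
  have key : ∀ a j, (a = r' ∧ j = i) ∨ (a = r' ∧ j = i') ∨
      (¬ (a = r' ∧ j = i) ∧ ¬ (a = r' ∧ j = i') ∧
        ∀ x y, setPair s r' i i' x y a j = s a j) := by
    intro a j
    by_cases h1 : a = r' ∧ j = i
    · exact Or.inl h1
    by_cases h2 : a = r' ∧ j = i'
    · exact Or.inr (Or.inl h2)
    · exact Or.inr (Or.inr ⟨h1, h2, fun x y => by simp only [setPair, if_neg h1, if_neg h2]⟩)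
  have hx : setPair s r' i i' x y r' i = x := by simp [setPair]
  have hy : setPair s r' i i' x y r' i' = y := by simp [setPair, hne']
  rcases h with ⟨a, j, h⟩ | ⟨a, j, h⟩ | ⟨a, j, h⟩ | ⟨a, j, h⟩
  · rcases key a j with ⟨rfl, rfl⟩ | ⟨rfl, rfl⟩ | ⟨h2, h3, hs⟩
    · rw [hx] at h; simp [h]
    · rw [hy] at h; simp [h]
    · left
      refine ⟨?_, fun x' y' => .top_right a j (by rw [hs] at h ⊢; exact h)⟩
      by_contra hcon
      have h1 : ¬ (a = r ∧ j = i) := by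
        rintro ⟨rfl, rfl⟩
        rw [hs, hn] at h
        exact absurd h (by decide)
      simp only [CupSeg, Fin.val_castSucc, Fin.val_succ, Fin.ext_iff] at hcon h1 h2 h3
      omega
  · rcases key a j with ⟨rfl, rfl⟩ | ⟨rfl, rfl⟩ | ⟨h2, h3, hs⟩
    · rw [hx] at h; simp [h]
    · rw [hy] at h; simp [h, hcs]
    · left
      refine ⟨?_, fun x' y' => .left_bottom a j (by rw [hs] at h ⊢; exact h)⟩
      by_contra hcon
      have h1 : ¬ (a = r ∧ j = i) := by
        rintro ⟨rfl, rfl⟩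
        rw [hs, hn] at h
        exact absurd h (by decide)
      simp only [CupSeg, Fin.val_castSucc, Fin.val_succ, Fin.ext_iff] at hcon h1 h2 h3
      omega
  · rcases key a j with ⟨rfl, rfl⟩ | ⟨rfl, rfl⟩ | ⟨h2, h3, hs⟩
    · rw [hx] at h; simp [h]
    · rw [hy] at h; simp [h, hcs]
    · left
      refine ⟨?_, fun x' y' => .top_left a j (by rw [hs] at h ⊢; exact h)⟩
      by_contra hcon
      have h1 : ¬ (a = r ∧ j = i') := by
        rintro ⟨rfl, rfl⟩
        rw [hs, hp] at h
        exact absurd h (by decide)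
      simp only [CupSeg, Fin.val_castSucc, Fin.ext_iff] at hcon h1 h2 h3
      omega
  · rcases key a j with ⟨rfl, rfl⟩ | ⟨rfl, rfl⟩ | ⟨h2, h3, hs⟩
    · rw [hx] at h; simp [h]
    · rw [hy] at h; simp [h]
    · left
      refine ⟨?_, fun x' y' => .right_bottom a j (by rw [hs] at h ⊢; exact h)⟩
      by_contra hcon
      have h1 : ¬ (a = r ∧ j = i') := by
        rintro ⟨rfl, rfl⟩
        rw [hs, hp] at h
        exact absurd h (by decide)
      simp only [CupSeg, Fin.val_succ, Fin.ext_iff] at hcon h1 h2 h3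
      omega

/-- Markers `(1,-1)` below the cup close it to a circle. With `(1,1)` or `(-1,-1)` the same segments
are inserted into a strand passing through, so removing the circle leaves the same connections. -/
theorem cup_collapse (hc : IsCup s r r' i i') :
    (∀ C, Realizes (setPair s r' i i' 1 1) C ↔ Realizes (setPair s r' i i' 1 (-1)) C) ∧
    (∀ C, Realizes (setPair s r' i i' (-1) (-1)) C ↔ Realizes (setPair s r' i i' 1 (-1)) C) ∧
    numClosed (setPair s r' i i' 1 (-1)) = numClosed (setPair s r' i i' 1 1) + 1 ∧
    numClosed (setPair s r' i i' 1 (-1)) = numClosed (setPair s r' i i' (-1) (-1)) + 1 := by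
  classical
  have hr := hc.row
  have hi := hc.col
  have hne : r ≠ r' := by rintro rfl; omega
  have hne' : i' ≠ i := by rintro rfl; omega
  have hcs : i'.castSucc = i.succ := Fin.ext (by simp [hi])
  have hrs : r'.castSucc = r.succ := Fin.ext (by simp [hr])
  have jx : ∀ x y, setPair s r' i i' x y r' i = x := by simp [setPair]
  have jy : ∀ x y, setPair s r' i i' x y r' i' = y := by simp [setPair, hne']
  have hn : ∀ x y, setPair s r' i i' x y r i = -1 := by simp [setPair, hne, hc.neg]
  have hp : ∀ x y, setPair s r' i i' x y r i' = 1 := by simp [setPair, hne, hc.pos]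
  -- the cup
  have c₁ : ∀ x y, component (setPair s r' i i' x y) (.vert r'.castSucc i) =
      component (setPair s r' i i' x y) (.horiz r i.succ) := fun x y => by
    rw [hrs]; exact (component_eq_of_joined (.right_bottom r i (hn x y))).symm
  have c₂ : ∀ x y, component (setPair s r' i i' x y) (.vert r'.castSucc i') =
      component (setPair s r' i i' x y) (.horiz r i.succ) := fun x y => by
    rw [hrs, ← hcs]; exact (component_eq_of_joined (.left_bottom r i' (hp x y))).symm
  -- the crossings below it
  have p₁ : ∀ y, component (setPair s r' i i' 1 y) (.vert r'.castSucc i) =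
      component (setPair s r' i i' 1 y) (.horiz r' i.succ) := fun y =>
    component_eq_of_joined (.top_right r' i (jx 1 y))
  have p₂ : ∀ y, component (setPair s r' i i' 1 y) (.horiz r' i.castSucc) =
      component (setPair s r' i i' 1 y) (.vert r'.succ i) := fun y =>
    component_eq_of_joined (.left_bottom r' i (jx 1 y))
  have n₁ : ∀ y, component (setPair s r' i i' (-1) y) (.vert r'.castSucc i) =
      component (setPair s r' i i' (-1) y) (.horiz r' i.castSucc) := fun y =>
    component_eq_of_joined (.top_left r' i (jx _ y))
  have n₂ : ∀ y, component (setPair s r' i i' (-1) y) (.horiz r' i.succ) =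
      component (setPair s r' i i' (-1) y) (.vert r'.succ i) := fun y =>
    component_eq_of_joined (.right_bottom r' i (jx _ y))
  have p₃ : ∀ x, component (setPair s r' i i' x 1) (.vert r'.castSucc i') =
      component (setPair s r' i i' x 1) (.horiz r' i'.succ) := fun x =>
    component_eq_of_joined (.top_right r' i' (jy x 1))
  have p₄ : ∀ x, component (setPair s r' i i' x 1) (.horiz r' i.succ) =
      component (setPair s r' i i' x 1) (.vert r'.succ i') := fun x => by
    rw [← hcs]; exact component_eq_of_joined (.left_bottom r' i' (jy x 1))
  have n₃ : ∀ x, component (setPair s r' i i' x (-1)) (.vert r'.castSucc i') =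
      component (setPair s r' i i' x (-1)) (.horiz r' i.succ) := fun x => by
    rw [← hcs]; exact component_eq_of_joined (.top_left r' i' (jy x _))
  have n₄ : ∀ x, component (setPair s r' i i' x (-1)) (.horiz r' i'.succ) =
      component (setPair s r' i i' x (-1)) (.vert r'.succ i') := fun x =>
    component_eq_of_joined (.right_bottom r' i' (jy x _))
  -- which of these segments belong to the strand
  have fT : CupSeg r r' i i' (.vert r'.castSucc i) := by simp [CupSeg]
  have fT' : CupSeg r r' i i' (.vert r'.castSucc i') := by simp [CupSeg]
  have fM : CupSeg r r' i i' (.horiz r' i.succ) := by simp [CupSeg, hi]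
  have fL : ¬ CupSeg r r' i i' (.horiz r' i.castSucc) := by simp [CupSeg]; omega
  have fR : ¬ CupSeg r r' i i' (.horiz r' i'.succ) := by simp [CupSeg]
  have fB : ∀ j, ¬ CupSeg r r' i i' (.vert r'.succ j) := by simp [CupSeg]
  have cup : ∀ x y u, CupSeg r r' i i' u → u = .horiz r' i.succ ∨
      component (setPair s r' i i' x y) u = component (setPair s r' i i' x y)
        (.horiz r i.succ) := by
    rintro x y (⟨a, j⟩ | ⟨a, j⟩) hu
    · right
      obtain ⟨ha, rfl | rfl⟩ := hu
      · rw [show a = r'.castSucc from Fin.ext ha]; exact c₁ x y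
      · rw [show a = r'.castSucc from Fin.ext ha]; exact c₂ x y
    · obtain ⟨rfl | rfl, hj⟩ := hu
      · right; rw [show j = i.succ from Fin.ext (by simp [hj, hi])]
      · left; rw [show j = i.succ from Fin.ext (by simp [hj, hi])]
  -- Here `z` is a segment outside the cup strand to which that strand is attached: the right one
  -- for `(1,1)`, the left one for `(-1,-1)`. The collapsing map sends the whole strand to `z`.
  have main : ∀ (x y : ℤˣ) (z : Seg m n), ¬ CupSeg r r' i i' z →
      (∀ u, CupSeg r r' i i' u →
        component (setPair s r' i i' x y) u = component (setPair s r' i i' x y) z) →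
      ((x = 1 ∧ y = 1 ∧ z = .horiz r' i'.succ) ∨ (x = -1 ∧ y = -1 ∧ z = .horiz r' i.castSucc)) →
      (∀ C, Realizes (setPair s r' i i' x y) C ↔ Realizes (setPair s r' i i' 1 (-1)) C) ∧
      numClosed (setPair s r' i i' 1 (-1)) = numClosed (setPair s r' i i' x y) + 1 := by
    intro x y z hz hFz hxy
    have hid : ∀ u, ¬ CupSeg r r' i i' u → (if CupSeg r r' i i' u then z else u) = u :=
      fun u hu => if_neg hu
    refine component_collapse (CupSeg r r' i i')
      (fun u => if CupSeg r r' i i' u then z else u) hid ?_ (not_cupSeg_seg hr hi) ?_ ?_ ?_ ?_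
      (.horiz r' i.succ) fM ?_
    · intro u
      split_ifs with hu
      · exact hz
      · exact hu
    · intro u v h
      rcases joined_setPair_cases hc h with ⟨hF, h⟩ | ⟨rfl, rfl, rfl⟩ | ⟨rfl, rfl, rfl⟩ |
        ⟨rfl, rfl, rfl⟩ | ⟨rfl, rfl, rfl⟩ | ⟨rfl, rfl, rfl⟩ | ⟨rfl, rfl, rfl⟩ |
        ⟨rfl, rfl, rfl⟩ | ⟨rfl, rfl, rfl⟩
      · by_cases hu : CupSeg r r' i i' u
        · rw [if_pos hu, if_pos (hF.1 hu)]
        · rw [if_neg hu, if_neg (mt hF.2 hu)]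
          exact component_eq_of_joined (h _ _)
      · rw [if_pos fT, if_pos fM]
      · rw [if_neg fL, if_neg (fB _)]; exact p₂ _
      · rw [if_pos fT, if_neg fL]
        rcases hxy with ⟨h, -⟩ | ⟨-, -, rfl⟩
        · exact absurd h (by decide)
        · rfl
      · rw [if_pos fM, if_neg (fB _)]
        rcases hxy with ⟨h, -⟩ | ⟨-, -, rfl⟩
        · exact absurd h (by decide)
        · exact p₂ _
      · rw [if_pos fT', if_neg fR]
        rcases hxy with ⟨-, -, rfl⟩ | ⟨-, h, -⟩
        · rfl
        · exact absurd h (by decide)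
      · rw [if_pos fM, if_neg (fB _)]
        rcases hxy with ⟨-, -, rfl⟩ | ⟨-, h, -⟩
        · exact n₄ _
        · exact absurd h (by decide)
      · rw [if_pos fT', if_pos fM]
      · rw [if_neg fR, if_neg (fB _)]; exact n₄ _
    · intro u v h
      have hM := hFz _ fM
      have hT := hFz _ fT
      have hT' := hFz _ fT'
      rcases joined_setPair_cases hc h with ⟨-, h⟩ | ⟨-, rfl, rfl⟩ | ⟨-, rfl, rfl⟩ |
        ⟨h, -⟩ | ⟨h, -⟩ | ⟨h, -⟩ | ⟨h, -⟩ | ⟨-, rfl, rfl⟩ | ⟨-, rfl, rfl⟩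
      · exact component_eq_of_joined (h _ _)
      · rw [hT, hM]
      · rcases hxy with ⟨rfl, rfl, rfl⟩ | ⟨rfl, rfl, rfl⟩
        · exact p₂ _
        · rw [← hM]; exact n₂ _
      · exact absurd h (by decide)
      · exact absurd h (by decide)
      · exact absurd h (by decide)
      · exact absurd h (by decide)
      · rw [hT', hM]
      · rcases hxy with ⟨rfl, rfl, rfl⟩ | ⟨rfl, rfl, rfl⟩
        · rw [← hM]; exact p₄ _
        · exact n₄ _
    · intro u
      split_ifs with hu
      · exact hFz u hu
      · rfl
    · intro u v h
      rcases joined_setPair_cases hc h with ⟨hF, -⟩ | ⟨-, rfl, rfl⟩ | ⟨-, rfl, rfl⟩ |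
        ⟨h, -⟩ | ⟨h, -⟩ | ⟨h, -⟩ | ⟨h, -⟩ | ⟨-, rfl, rfl⟩ | ⟨-, rfl, rfl⟩
      · exact hF
      · exact iff_of_true fT fM
      · exact iff_of_false fL (fB _)
      · exact absurd h (by decide)
      · exact absurd h (by decide)
      · exact absurd h (by decide)
      · exact absurd h (by decide)
      · exact iff_of_true fT' fM
      · exact iff_of_false fR (fB _)
    · intro u hu
      rcases cup 1 (-1) u hu with rfl | h
      · rfl
      · rw [h, ← c₁]; exact p₁ _
  have h₁ := main 1 1 (.horiz r' i'.succ) fR (fun u hu => by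
    rw [← p₃, c₂]
    rcases cup 1 1 u hu with rfl | h
    · rw [← p₁, c₁]
    · exact h) (Or.inl ⟨rfl, rfl, rfl⟩)
  have h₂ := main (-1) (-1) (.horiz r' i.castSucc) fL (fun u hu => by
    rw [← n₁, c₁]
    rcases cup (-1) (-1) u hu with rfl | h
    · rw [← n₃, c₂]
    · exact h) (Or.inr ⟨rfl, rfl, rfl⟩)
  exact ⟨h₁.1, h₂.1, h₁.2, h₂.2⟩

end Cup

/-! ### The contribution of a Kauffman state -/

theorem numPos_sub_numNeg (s : KauffmanState m n) :
    (numPos s : ℤ) - numNeg s = ∑ x : Fin m × Fin n, ((s x.1 x.2 : ℤˣ) : ℤ) := by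
  rw [numPos, numNeg, Finset.card_filter, Finset.card_filter]
  push_cast
  rw [← Finset.sum_sub_distrib]
  refine Finset.sum_congr rfl fun x _ => ?_
  rcases Int.units_eq_one_or (s x.1 x.2) with h | h <;> rw [h] <;> decide

open Classical in
/-- The contribution of the Kauffman state `s` to the coefficient of `C`. -/
def CatalanState.term (C : CatalanState m n) (s : KauffmanState m n) : ℤ[T;T⁻¹] :=
  if Realizes s C then
    T ((numPos s : ℤ) - (numNeg s : ℤ)) * (-T 2 - T (-2)) ^ numClosed s else 0

theorem CatalanState.coeff_eq_sum_term (C : CatalanState m n) : C.coeff = ∑ s, C.term s := by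
  rw [CatalanState.coeff, Finset.sum_filter]
  rfl

theorem setPair_exponent (s : KauffmanState m n) (r : Fin m) {i i' : Fin n} (hi : i ≠ i') :
    ∃ e : ℤ, ∀ x y : ℤˣ, (numPos (setPair s r i i' x y) : ℤ) - numNeg (setPair s r i i' x y) =
      e + x + y := by
  refine ⟨∑ z : Fin m × Fin n, if z = (r, i) then 0 else if z = (r, i') then 0 else
    ((s z.1 z.2 : ℤˣ) : ℤ), fun x y => ?_⟩
  rw [numPos_sub_numNeg]
  have h1 : (x : ℤ) = ∑ z : Fin m × Fin n, if z = (r, i) then (x : ℤ) else 0 := by simp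
  have h2 : (y : ℤ) = ∑ z : Fin m × Fin n, if z = (r, i') then (y : ℤ) else 0 := by simp
  rw [h1, h2, ← Finset.sum_add_distrib, ← Finset.sum_add_distrib]
  refine Finset.sum_congr rfl fun z _ => ?_
  obtain ⟨a, j⟩ := z
  simp only [setPair, Prod.mk.injEq]
  by_cases h : a = r ∧ j = i
  · have : ¬ (a = r ∧ j = i') := fun h' => hi (h.2.symm.trans h'.2)
    simp [h, hi]
  · by_cases h' : a = r ∧ j = i'
    · simp [h', hi.symm]
    · simp [h, h']

/-- With a common exponent `e` and number of circles, the terms are `A^(e+2)`, `A^e (-A^2 - A^(-2))`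
and `A^(e-2)`. -/
theorem term_add_term_add_term (C : CatalanState m n) {s : KauffmanState m n} {r r' : Fin m}
    {i i' : Fin n} (hc : IsCup s r r' i i') :
    C.term (setPair s r' i i' 1 1) + C.term (setPair s r' i i' 1 (-1)) +
      C.term (setPair s r' i i' (-1) (-1)) = 0 := by
  obtain ⟨h1, h2, h3, h4⟩ := cup_collapse hc
  obtain ⟨e, he⟩ := setPair_exponent s r' (i := i) (i' := i')
    (by rintro rfl; have := hc.col; omega)
  unfold CatalanState.term
  rw [h1, h2]
  split_ifs with h
  · rw [he, he, he, show numClosed (setPair s r' i i' (-1) (-1)) =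
      numClosed (setPair s r' i i' 1 1) by omega, h3, pow_succ]
    have e1 : e + ((1 : ℤˣ) : ℤ) + ((1 : ℤˣ) : ℤ) = e + 2 := by push_cast; ring
    have e2 : e + ((1 : ℤˣ) : ℤ) + ((-1 : ℤˣ) : ℤ) = e := by push_cast; ring
    have e3 : e + ((-1 : ℤˣ) : ℤ) + ((-1 : ℤˣ) : ℤ) = e + (-2) := by push_cast; ring
    rw [e1, e2, e3, T_add, T_add]
    ring
  · simp

/-! ### Cancellation -/

/-- The markers in row `r`, columns `i` and `i + 1`, are `-1` and `1`. -/
def HasCup (s : KauffmanState m n) (r i : ℕ) : Prop :=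
  ∃ (h : r < m) (h' : i + 1 < n), s ⟨r, h⟩ ⟨i, by omega⟩ = -1 ∧ s ⟨r, h⟩ ⟨i + 1, h'⟩ = 1

/-- There is a cup in row `r` which is not repeated in the next row. -/
def IsTerminal (s : KauffmanState m n) (r i : ℕ) : Prop :=
  r + 1 < m ∧ HasCup s r i ∧ ¬ HasCup s (r + 1) i

/-- The first terminal cup is at `(r, i)`. -/
def IsFirstTerminal (s : KauffmanState m n) (x : ℕ × ℕ) : Prop :=
  IsTerminal s x.1 x.2 ∧ ∀ a j, a < x.1 ∨ (a = x.1 ∧ j < x.2) → ¬ IsTerminal s a j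

theorem units_cases (x y : ℤˣ) (h : ¬ (x = -1 ∧ y = 1)) :
    (x = 1 ∧ y = 1) ∨ (x = 1 ∧ y = -1) ∨ (x = -1 ∧ y = -1) := by
  revert x y; decide

theorem setPair_self (s : KauffmanState m n) (r : Fin m) (i i' : Fin n) :
    setPair s r i i' (s r i) (s r i') = s := by
  ext a j
  simp only [setPair]
  split_ifs with h h
  · rw [h.1, h.2]
  · rw [h.1, h.2]
  · rfl

theorem setPair_setPair (s : KauffmanState m n) (r : Fin m) (i i' : Fin n) (x y x' y' : ℤˣ) :
    setPair (setPair s r i i' x y) r i i' x' y' = setPair s r i i' x' y' := by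
  ext a j
  simp only [setPair]
  split_ifs <;> rfl

section Rotate

variable (r : Fin m) (i i' : Fin n)

/-- Permute the three smoothings below a cup cyclically. -/
def rotate (s : KauffmanState m n) : KauffmanState m n :=
  setPair s r i i' (s r i * s r i') (-s r i)

variable {r i i'}

theorem rotate_setPair (hi : i ≠ i') (s : KauffmanState m n) (x y : ℤˣ) :
    rotate r i i' (setPair s r i i' x y) = setPair s r i i' (x * y) (-x) := by
  rw [rotate, setPair_setPair]
  simp [setPair, hi.symm]

/-- The map `(x, y) ↦ (xy, -x)` runs through `(1,1)`, `(1,-1)`, `(-1,-1)` cyclically and fixes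
`(-1,1)`, the case of a repeated cup. -/
theorem rotate_rotate_rotate (hi : i ≠ i') (s : KauffmanState m n) :
    rotate r i i' (rotate r i i' (rotate r i i' s)) = s := by
  conv_rhs => rw [← setPair_self s r i i']
  conv_lhs => rw [← setPair_self s r i i']
  rw [rotate_setPair hi, rotate_setPair hi, rotate_setPair hi]
  rcases Int.units_eq_one_or (s r i) with h | h <;>
    rcases Int.units_eq_one_or (s r i') with h' | h' <;> simp [h, h']

theorem term_rotate (C : CatalanState m n) {s : KauffmanState m n} {r' : Fin m}
    (hc : IsCup s r r' i i') (h : ¬ (s r' i = -1 ∧ s r' i' = 1)) :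
    C.term s + C.term (rotate r' i i' s) + C.term (rotate r' i i' (rotate r' i i' s)) = 0 := by
  have hi : i ≠ i' := by rintro rfl; have := hc.col; omega
  have h0 := term_add_term_add_term C hc
  obtain ⟨x, y, hxy, hs⟩ : ∃ x y, ((x = 1 ∧ y = 1) ∨ (x = 1 ∧ y = -1) ∨ (x = -1 ∧ y = -1)) ∧
      setPair s r' i i' x y = s := ⟨_, _, units_cases _ _ h, setPair_self s r' i i'⟩
  have e1 : rotate r' i i' s = setPair s r' i i' (x * y) (-x) := by
    conv_lhs => rw [← hs]
    exact rotate_setPair hi _ _ _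
  rw [e1, rotate_setPair hi]
  conv_lhs => enter [1, 1]; rw [← hs]
  rcases hxy with ⟨rfl, rfl⟩ | ⟨rfl, rfl⟩ | ⟨rfl, rfl⟩
  · simpa using h0
  · rw [← h0]; simp only [mul_neg, mul_one, neg_neg]; ring
  · rw [← h0]; simp only [mul_neg, mul_one, neg_neg]; ring

theorem rotate_apply_of_ne {s : KauffmanState m n} {a : Fin m} {j : Fin n}
    (h : a ≠ r ∨ (j ≠ i ∧ j ≠ i')) : rotate r i i' s a j = s a j := by
  simp only [rotate, setPair]
  rw [if_neg (by tauto), if_neg (by tauto)]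

theorem hasCup_rotate_of_ne {s : KauffmanState m n} (hi : (i' : ℕ) = i + 1) {a j : ℕ}
    (h : a ≠ r ∨ j + 1 < i) : HasCup (rotate r i i' s) a j ↔ HasCup s a j := by
  refine exists_congr fun ha => exists_congr fun hj => ?_
  rw [rotate_apply_of_ne, rotate_apply_of_ne] <;> simp only [ne_eq, Fin.ext_iff] <;> omega

theorem hasCup_rotate {s : KauffmanState m n} (hi : (i' : ℕ) = i + 1) :
    HasCup (rotate r i i' s) r i ↔ HasCup s r i := by
  refine exists_congr fun ha => exists_congr fun hj => ?_
  have hi' : (⟨(i : ℕ) + 1, hj⟩ : Fin n) = i' := Fin.ext hi.symm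
  have hne : i' ≠ i := by rintro rfl; omega
  rw [hi']
  simp only [Fin.eta, rotate, setPair, and_self, if_true, hne, and_false, if_false]
  generalize s r i = x
  generalize s r i' = y
  revert x y
  decide

theorem isFirstTerminal_rotate {s : KauffmanState m n} {r : ℕ} (hr : r + 1 < m)
    (hi : (i' : ℕ) = i + 1) (h : IsFirstTerminal s (r, i)) :
    IsFirstTerminal (rotate ⟨r + 1, hr⟩ i i' s) (r, i) := by
  obtain ⟨⟨-, h1, h2⟩, h3⟩ := h
  refine ⟨⟨hr, (hasCup_rotate_of_ne hi (Or.inl (by simp))).2 h1,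
    fun h => h2 ((hasCup_rotate (r := ⟨r + 1, hr⟩) hi).1 h)⟩, ?_⟩
  rintro a j haj ⟨h4, h5, h6⟩
  rw [hasCup_rotate_of_ne hi (Or.inl (by simp only; omega))] at h5
  rcases haj with haj | ⟨rfl, haj⟩
  · exact h3 a j (Or.inl haj) ⟨h4, h5, fun h => h6
      ((hasCup_rotate_of_ne hi (Or.inl (by simp only; omega))).2 h)⟩
  -- The rotation could affect a cup in row `r + 1` at column `i - 1`, but no cup sits above it in
  -- row `r`: that would need the marker `1` in column `i`, where the given cup has `-1`.
  · by_cases hj : j + 1 = i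
    · obtain ⟨ha, h7, h8, -⟩ := h1
      obtain ⟨ha', h7', -, h9⟩ := h5
      simp only [hj] at h9
      rw [h9] at h8
      exact absurd h8 (by decide)
    · exact h3 a j (Or.inr ⟨rfl, haj⟩) ⟨h4, h5, fun h => h6
        ((hasCup_rotate_of_ne hi (Or.inr (by omega))).2 h)⟩

end Rotate

-- The rotation permutes the states with a given first terminal cup, and each orbit sum of terms
-- vanishes.
open Classical in
theorem sum_isFirstTerminal (C : CatalanState m n) (x : ℕ × ℕ) :
    ∑ s ∈ Finset.univ.filter (fun s => IsFirstTerminal s x), C.term s = 0 := by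
  obtain ⟨r, i⟩ := x
  by_cases hb : r + 1 < m ∧ i + 1 < n
  · obtain ⟨hr, hi⟩ := hb
    set S := Finset.univ.filter (fun s : KauffmanState m n => IsFirstTerminal s (r, i)) with hS
    set g : KauffmanState m n → KauffmanState m n :=
      rotate ⟨r + 1, hr⟩ ⟨i, by omega⟩ ⟨i + 1, hi⟩ with hg
    have hgS : ∀ s ∈ S, g s ∈ S := by
      intro s hs
      rw [hS, Finset.mem_filter] at hs ⊢
      exact ⟨Finset.mem_univ _, isFirstTerminal_rotate hr (i := ⟨i, by omega⟩) rfl hs.2⟩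
    have hg3 : ∀ s, g (g (g s)) = s := fun s => rotate_rotate_rotate (by simp) s
    have h1 : ∀ F : KauffmanState m n → ℤ[T;T⁻¹], ∑ s ∈ S, F (g s) = ∑ s ∈ S, F s := fun F =>
      Finset.sum_nbij' g (fun s => g (g s)) hgS (fun s hs => hgS _ (hgS s hs))
        (fun s _ => hg3 s) (fun s _ => hg3 s) (fun _ _ => rfl)
    have h2 : ∑ s ∈ S, (C.term s + C.term (g s) + C.term (g (g s))) = 0 := by
      refine Finset.sum_eq_zero fun s hs => ?_
      rw [hS, Finset.mem_filter] at hs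
      obtain ⟨-, ⟨-, ⟨ha, hj, h3, h4⟩, h5⟩, -⟩ := hs
      exact term_rotate C (r := ⟨r, ha⟩) ⟨rfl, rfl, h3, h4⟩ fun h => h5 ⟨hr, hi, h.1, h.2⟩
    rw [Finset.sum_add_distrib, Finset.sum_add_distrib, h1 (fun s => C.term (g s)), h1] at h2
    -- Summing over the set counts every state three times; Laurent polynomials over `ℤ` have no
    -- torsion.
    have h3 : (3 : ℕ) • ∑ s ∈ S, C.term s = 0 := by
      rw [← h2]; simp only [nsmul_eq_mul]; push_cast; ring
    exact (smul_eq_zero.1 h3).resolve_left (by norm_num)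
  · refine Finset.sum_eq_zero fun s hs => ?_
    rw [Finset.mem_filter] at hs
    obtain ⟨-, ⟨hr, ⟨-, hi, -⟩, -⟩, -⟩ := hs
    exact absurd ⟨hr, hi⟩ hb

theorem exists_isFirstTerminal {s : KauffmanState m n} {r i : ℕ} (h : IsTerminal s r i) :
    ∃ x, IsFirstTerminal s x := by
  classical
  have h1 : ∃ r i, IsTerminal s r i := ⟨r, i, h⟩
  have h2 := Nat.find_spec h1
  refine ⟨(Nat.find h1, Nat.find h2), Nat.find_spec h2, ?_⟩
  rintro a j (haj | ⟨rfl, haj⟩) hT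
  · exact Nat.find_min h1 haj ⟨j, hT⟩
  · exact Nat.find_min h2 haj hT

theorem isFirstTerminal_unique {s : KauffmanState m n} {x y : ℕ × ℕ}
    (hx : IsFirstTerminal s x) (hy : IsFirstTerminal s y) : x = y := by
  have h1 : ¬ _ := fun h => hx.2 y.1 y.2 h hy.1
  have h2 : ¬ _ := fun h => hy.2 x.1 x.2 h hx.1
  ext <;> omega

theorem hasCup_last {s : KauffmanState m n} (hs : ∀ r i, ¬ IsTerminal s r i) {r i : ℕ}
    (h : HasCup s r i) : HasCup s (m - 1) i := by
  have hr : r < m := h.1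
  obtain ⟨d, hd⟩ : ∃ d, m - 1 = r + d := ⟨m - 1 - r, by omega⟩
  rw [hd]
  have : ∀ e, r + e < m → HasCup s (r + e) i := by
    intro e
    induction e with
    | zero => exact fun _ => h
    | succ e ih =>
      intro he
      by_contra hcon
      exact hs (r + e) i ⟨he, ih (by omega), hcon⟩
  exact this d (by omega)

theorem not_realizes_of_hasCup {C : CatalanState m n} (hF : C.NoFloorReturns)
    {s : KauffmanState m n} {i : ℕ} (h : HasCup s (m - 1) i) : ¬ Realizes s C := by
  intro hR
  obtain ⟨hm, hi, h1, h2⟩ := h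
  have e1 := component_eq_of_joined (.right_bottom _ _ h1)
  have e2 := component_eq_of_joined (.left_bottom _ _ h2)
  have hl : (⟨m - 1, hm⟩ : Fin m).succ = Fin.last m := Fin.ext (by simp; omega)
  rw [hl] at e1 e2
  have h3 := (hR (.bot ⟨i, by omega⟩) (.bot ⟨i + 1, hi⟩) (by simp)).1 (e1.symm.trans e2)
  refine hF (.bot ⟨i, by omega⟩) trivial ?_
  rw [h3]
  trivial

/-- Without the pattern `-1, 1`, everything after the first `-1` is `-1`. -/
theorem exists_threshold {f : Fin n → ℤˣ}
    (hf : ∀ (i : ℕ) (h : i + 1 < n), f ⟨i, by omega⟩ = -1 → f ⟨i + 1, h⟩ = -1) :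
    ∃ v : Fin (n + 1), ∀ j : Fin n, f j = if (j : ℕ) < v then 1 else -1 := by
  classical
  by_cases hex : ∃ i, ∃ h : i < n, f ⟨i, h⟩ = -1
  · obtain ⟨hv, hv'⟩ := Nat.find_spec hex
    refine ⟨⟨Nat.find hex, by omega⟩, fun j => ?_⟩
    simp only
    split_ifs with hj
    · refine (Int.units_eq_one_or _).resolve_right fun h => ?_
      exact Nat.find_min hex hj ⟨j.2, h⟩
    · obtain ⟨d, hd⟩ : ∃ d, (j : ℕ) = Nat.find hex + d := ⟨j - Nat.find hex, by omega⟩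
      have : ∀ e, ∀ he : Nat.find hex + e < n, f ⟨Nat.find hex + e, he⟩ = -1 := by
        intro e
        induction e with
        | zero => exact fun _ => hv'
        | succ e ih => exact fun he => hf _ he (ih (by omega))
      rw [← this d (by omega)]
      congr 1
      exact Fin.ext hd
  · refine ⟨Fin.last n, fun j => ?_⟩
    rw [if_pos (by simp)]
    exact (Int.units_eq_one_or _).resolve_right fun h => hex ⟨j, j.2, h⟩

theorem exists_stateOf_eq {s : KauffmanState m n} (hs : ∀ r i, ¬ HasCup s r i) :
    ∃ b, stateOf b = s := by
  have : ∀ r : Fin m, ∃ v : Fin (n + 1), ∀ j : Fin n, s r j = if (j : ℕ) < v then 1 else -1 :=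
    fun r => exists_threshold fun i h h1 => (Int.units_eq_one_or _).resolve_left
      fun h2 => hs r i ⟨r.2, h, h1, h2⟩
  choose b hb using this
  refine ⟨b, ?_⟩
  ext r j
  rw [hb]
  rfl

theorem not_hasCup_stateOf (b : Fin m → Fin (n + 1)) (r i : ℕ) : ¬ HasCup (stateOf b) r i := by
  rintro ⟨hr, hi, h1, h2⟩
  simp only [stateOf] at h1 h2
  split_ifs at h1 h2
  all_goals first | exact absurd h1 (by decide) | exact absurd h2 (by decide) | omega

theorem stateOf_injective :
    Function.Injective (stateOf : (Fin m → Fin (n + 1)) → KauffmanState m n) := by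
  intro b b' h
  have key : ∀ b b' : Fin m → Fin (n + 1), stateOf b = stateOf b' → ∀ r, b r ≤ b' r := by
    intro b b' h r
    by_contra hlt
    have hj : (b' r : ℕ) < n := by omega
    have := congrFun (congrFun h r) ⟨b' r, hj⟩
    rw [stateOf_of_lt (by simp only; omega), stateOf_of_le (by simp)] at this
    exact absurd this (by decide)
  exact funext fun r => le_antisymm (key b b' h r) (key b' b h.symm r)

theorem exponent_stateOf (b : Fin m → Fin (n + 1)) :
    (numPos (stateOf b) : ℤ) - numNeg (stateOf b) = 2 * (weight b : ℤ) - m * n := by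
  rw [numPos_sub_numNeg, Fintype.sum_prod_type]
  have : ∀ r : Fin m, ∑ j : Fin n, ((stateOf b r j : ℤˣ) : ℤ) = 2 * (b r : ℕ) - n := by
    intro r
    have h1 : ∀ j : Fin n, ((stateOf b r j : ℤˣ) : ℤ) =
        2 * (if (j : ℕ) < b r then 1 else 0) - 1 := by
      intro j
      unfold stateOf
      split_ifs <;> simp
    simp only [h1]
    rw [Finset.sum_sub_distrib, ← Finset.mul_sum]
    congr 1
    · congr 1
      rw [Finset.sum_boole, Fin.card_filter_val_lt]
      congr 1
      omega
    · simp
  rw [Finset.sum_congr rfl fun r _ => this r, Finset.sum_sub_distrib, ← Finset.mul_sum, weight]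
  simp

open Classical in
/-- Only the Kauffman states of sequences contribute to the coefficient. -/
theorem CatalanState.coeff_eq_sum_seqs {C : CatalanState m n} (hF : C.NoFloorReturns) :
    C.coeff = ∑ b : Fin m → Fin (n + 1), if GoodSeq C.Arc id b then
      T (2 * (weight b : ℤ) - (m : ℤ) * n) else 0 := by
  rw [C.coeff_eq_sum_term]
  have h1 : ∑ s ∈ Finset.univ.filter (fun s => ∃ x, IsFirstTerminal s x), C.term s = 0 := by
    have : Finset.univ.filter (fun s : KauffmanState m n => ∃ x, IsFirstTerminal s x) =
        (Finset.range m ×ˢ Finset.range n).biUnion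
          (fun x => Finset.univ.filter (fun s => IsFirstTerminal s x)) := by
      ext s
      simp only [Finset.mem_filter, Finset.mem_univ, true_and, Finset.mem_biUnion,
        Finset.mem_product, Finset.mem_range]
      constructor
      · rintro ⟨x, hx⟩
        obtain ⟨h1, h2, -, -⟩ := hx.1.2.1
        exact ⟨x, ⟨h1, by omega⟩, hx⟩
      · rintro ⟨x, -, hx⟩
        exact ⟨x, hx⟩
    rw [this, Finset.sum_biUnion]
    · exact Finset.sum_eq_zero fun x _ => sum_isFirstTerminal C x
    · intro x _ y _ hxy
      rw [Function.onFun, Finset.disjoint_left]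
      intro s hs hs'
      rw [Finset.mem_filter] at hs hs'
      exact hxy (isFirstTerminal_unique hs.2 hs'.2)
  rw [← Finset.sum_filter_add_sum_filter_not Finset.univ
    (fun s => ∃ x, IsFirstTerminal s x), h1, zero_add]
  have h2 : ∀ b : Fin m → Fin (n + 1), (if GoodSeq C.Arc id b then
      (T (2 * (weight b : ℤ) - (m : ℤ) * n) : ℤ[T;T⁻¹]) else 0) = C.term (stateOf b) := by
    intro b
    rw [CatalanState.term, realizes_stateOf_iff hF, exponent_stateOf, numClosed_stateOf, pow_zero,
      mul_one]
  rw [Finset.sum_congr rfl fun b _ => h2 b,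
    ← Finset.sum_image (s := Finset.univ) (f := C.term) (g := stateOf) stateOf_injective.injOn]
  symm
  apply Finset.sum_subset
  · intro s hs
    obtain ⟨b, -, rfl⟩ := Finset.mem_image.1 hs
    rw [Finset.mem_filter]
    refine ⟨Finset.mem_univ _, ?_⟩
    rintro ⟨x, hx⟩
    exact not_hasCup_stateOf b _ _ hx.1.2.1
  -- A state without terminal cups that is not of the form `stateOf b` has a cup, which persists
  -- down to the last row and rules out `C`.
  · intro s hs hs'
    rw [Finset.mem_filter] at hs
    have hT : ∀ r i, ¬ IsTerminal s r i := fun r i h => hs.2 (exists_isFirstTerminal h)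
    have hc : ∃ r i, HasCup s r i := by
      by_contra hcon
      push Not at hcon
      obtain ⟨b, rfl⟩ := exists_stateOf_eq hcon
      exact hs' (Finset.mem_image_of_mem _ (Finset.mem_univ b))
    obtain ⟨r, i, h⟩ := hc
    exact if_neg (not_realizes_of_hasCup hF (hasCup_last hT h))

/-! ### The recursion for Gaussian multinomial coefficients -/

-- An interval of length `∑ e i` is cut into blocks of lengths `e i`, ordered by decreasing `c`;
-- each block is shifted by the lengths of those with larger `c`. Empty blocks contribute zero, so
-- ties are harmless for them.
open Polynomial in
theorem qInt_sum {ι : Type*} [DecidableEq ι] (c : ι → ℤ) (e : ι → ℕ) (s : Finset ι)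
    (hc : ∀ i ∈ s, ∀ j ∈ s, i ≠ j → 0 < e i → 0 < e j → c i ≠ c j) :
    ∑ i ∈ s, X ^ (∑ j ∈ s with c i < c j, e j) * qInt (e i) = qInt (∑ i ∈ s, e i) := by
  induction s using Finset.induction_on_max_value c with
  | empty => simp [qInt]
  | insert i₀ s hi₀ hmax ih =>
    have ih' := ih fun i hi j hj => hc i (Finset.mem_insert_of_mem hi) j
      (Finset.mem_insert_of_mem hj)
    rw [Finset.sum_insert hi₀, Finset.sum_insert hi₀, qInt_add, ← ih', Finset.mul_sum]
    congr 1
    · rw [Finset.filter_false_of_mem, Finset.sum_empty, pow_zero, one_mul]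
      intro j hj
      rcases Finset.mem_insert.1 hj with rfl | hj
      · exact lt_irrefl _
      · exact not_lt.2 (hmax j hj)
    · refine Finset.sum_congr rfl fun i hi => ?_
      rw [Finset.filter_insert]
      split_ifs with h
      · rw [Finset.sum_insert (by simp [hi₀]), pow_add, mul_assoc]
      · have hci : c i = c i₀ := le_antisymm (hmax i hi) (not_lt.1 h)
        by_cases h0 : e i = 0
        · simp [h0, qInt]
        · have h1 : e i₀ = 0 := by
            by_contra h1
            exact hc i (Finset.mem_insert_of_mem hi) i₀ (Finset.mem_insert_self _ _)
              (fun h => hi₀ (h ▸ hi)) (by omega) (by omega) hci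
          rw [h1, pow_zero, one_mul]

theorem sum_update_succ {ι : Type*} [DecidableEq ι] (s : Finset ι) (d : ι → ℕ) (i : ι) :
    ∑ j ∈ s, Function.update d i (d i + 1) j = ∑ j ∈ s, d j + if i ∈ s then 1 else 0 := by
  have : ∀ j, Function.update d i (d i + 1) j = d j + if j = i then 1 else 0 := by
    intro j
    by_cases h : j = i
    · subst h; simp
    · simp [h]
  simp only [this, Finset.sum_add_distrib, Finset.sum_ite_eq']

theorem qMultinomial_succ_mul {k : ℕ} (e : Fin k → ℕ) (i : Fin k) :
    qMultinomial e * ∏ j, qFactorial (Function.update e i (e i + 1) j) =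
      qInt (e i + 1) * qFactorial (∑ j, e j) := by
  rw [← qMultinomial_mul, ← Finset.mul_prod_erase _ _ (Finset.mem_univ i),
    ← Finset.mul_prod_erase _ (fun j => qFactorial (e j)) (Finset.mem_univ i),
    Function.update_self, qFactorial_succ]
  rw [Finset.prod_congr rfl (fun j hj => by
    rw [Function.update_of_ne (Finset.ne_of_mem_erase hj)])]
  ring

open Polynomial in
/-- `f i` is the sequence `e` with the `i`-th entry lowered by one. -/
theorem qMultinomial_rec {k : ℕ} (c : Fin k → ℤ) (e : Fin k → ℕ) (he : 0 < ∑ i, e i)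
    (hc : ∀ i j, i ≠ j → 0 < e i → 0 < e j → c i ≠ c j) (f : Fin k → Fin k → ℕ)
    (hf : ∀ i, 0 < e i → Function.update (f i) i (f i i + 1) = e) :
    qMultinomial e = ∑ i, if 0 < e i then
      X ^ (∑ j with c i < c j, e j) * qMultinomial (f i) else 0 := by
  have hm : (∏ i, qFactorial (e i)).Monic :=
    Polynomial.monic_prod_of_monic _ _ fun i _ => qFactorial_monic (e i)
  apply mul_right_cancel₀ hm.ne_zero
  obtain ⟨N, hN⟩ : ∃ N, ∑ i, e i = N + 1 := ⟨_, (Nat.succ_pred_eq_of_pos he).symm⟩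
  -- The top factor `[N+1]` of the numerator is split by `qInt_sum`, one summand for each entry that
  -- can be lowered.
  rw [qMultinomial_mul, hN, qFactorial_succ, ← hN,
    ← qInt_sum c e Finset.univ fun i _ j _ => hc i j, Finset.mul_sum, Finset.sum_mul]
  refine Finset.sum_congr rfl fun i _ => ?_
  split_ifs with h
  · have h1 := qMultinomial_succ_mul (f i) i
    have h2 : f i i + 1 = e i := by
      conv_rhs => rw [← hf i h]
      simp
    have h3 : ∑ j, f i j = N := by
      have := sum_update_succ Finset.univ (f i) i
      rw [hf i h, if_pos (Finset.mem_univ _), hN] at this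
      omega
    rw [hf i h, h2, h3] at h1
    rw [mul_assoc, h1]
    ring
  -- For `e i = 0` nothing is known about `f i`, but the block has length zero.
  · rw [show e i = 0 by omega]
    simp [qInt]

theorem qMultinomial_zero {k : ℕ} {e : Fin k → ℕ} (he : ∑ i, e i = 0) : qMultinomial e = 1 := by
  have h := qMultinomial_mul e
  have h0 : ∀ i, e i = 0 := fun i => Finset.sum_eq_zero_iff.1 he i (Finset.mem_univ i)
  simpa [h0, qFactorial] using h

/-! ### Nested arcs around separated centres -/

/-- The groups of `a i` nested arcs around the centres `c i` are separated from each other. -/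
structure IsBranching {k : ℕ} (n : ℕ) (c : Fin k → ℤ) (a : Fin k → ℕ) : Prop where
  sep : ∀ i j, 0 < a i → 0 < a j → i ≠ j → c i + a i ≤ c j - a j ∨ c j + a j ≤ c i - a i
  nonneg : ∀ i, 0 < a i → 0 ≤ c i
  le : ∀ i, 0 < a i → c i ≤ n

/-- The number of the strand at the right end of the next arc around `c i`, when `d j` arcs around
each `c j` are present. -/
def nextVal {k : ℕ} (c : Fin k → ℤ) (d : Fin k → ℕ) (i : Fin k) : ℤ :=
  c i - (∑ j with c j < c i, d j : ℕ) + (∑ j with c i < c j, d j : ℕ)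

/-- The strands `β` are those that remain when `d i` arcs around each `c i` are present. -/
structure IsStage {k : ℕ} (n : ℕ) (c : Fin k → ℤ) (a : Fin k → ℕ) (β : ℤ → ℤ) (d : Fin k → ℕ) :
    Prop where
  mono : StrictMono β
  range : ∀ y, y ∈ Set.range β ↔ ∀ i, ¬ (c i - d i ≤ y ∧ y < c i + d i)
  neg : ∀ j < 0, β j = j - (∑ i, d i : ℕ)
  ge : ∀ j, (n : ℤ) ≤ j → β j = j + (∑ i, d i : ℕ)
  le : ∀ i, d i ≤ a i
  next : ∀ i, d i < a i → β (nextVal c d i) = c i + d i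

section Stage

variable {k n : ℕ} {c : Fin k → ℤ} {a : Fin k → ℕ} {β : ℤ → ℤ} {d : Fin k → ℕ}

theorem isStage_zero : IsStage n c a id 0 where
  mono := strictMono_id
  range y := by simp
  neg := by simp
  ge := by simp
  le := by simp
  next i _ := by simp [nextVal]

/-- Joining two strands moves the strands on their right one number down and those on their left one
number up; a family's own arcs leave its next value unchanged. -/
theorem nextVal_update (i l : Fin k) :
    nextVal c (Function.update d i (d i + 1)) l =
      nextVal c d l - (if c i < c l then 1 else 0) + (if c l < c i then 1 else 0) := by
  simp only [nextVal, sum_update_succ, Finset.mem_filter, Finset.mem_univ, true_and]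
  push_cast
  ring

/-- The point `c i - 1 - d i` is still free since the families are disjoint, and all points between
it and `c i + d i` are used up. By monotonicity it carries the preceding strand. -/
theorem IsStage.prev (hb : IsBranching n c a) (hs : IsStage n c a β d) {i : Fin k}
    (hi : d i < a i) : β (nextVal c d i - 1) = c i - 1 - d i := by
  have h1 : c i - 1 - d i ∈ Set.range β := by
    rw [hs.range]
    intro j
    by_cases hj : j = i
    · subst hj; omega
    · have := hs.le j
      by_cases h0 : 0 < a j
      · rcases hb.sep i j (by omega) h0 (Ne.symm hj) with h | h <;> omega
      · omega
  obtain ⟨w, hw⟩ := h1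
  have h2 := hs.next i hi
  have h3 : w ≤ nextVal c d i - 1 := by
    have : w < nextVal c d i := hs.mono.lt_iff_lt.1 (by omega)
    omega
  have h4 := hs.mono.monotone h3
  have h5 := hs.mono (show nextVal c d i - 1 < nextVal c d i by omega)
  have h6 := (hs.range (β (nextVal c d i - 1))).1 ⟨_, rfl⟩ i
  omega

/-- This and `nextVal_le` turn the bounds `0 ≤ c i ≤ n` into the statement that the next arc around
any unfinished centre can be made by an admissible row. -/
theorem IsStage.nextVal_nonneg (hb : IsBranching n c a) (hs : IsStage n c a β d) {i : Fin k}
    (hi : d i < a i) : 0 ≤ nextVal c d i := by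
  by_contra hcon
  have h1 := hs.neg _ (not_le.1 hcon)
  have h2 := hs.next i hi
  have h3 := hb.nonneg i (by omega)
  omega

theorem IsStage.nextVal_le (hb : IsBranching n c a) (hs : IsStage n c a β d) {i : Fin k}
    (hi : d i < a i) : nextVal c d i ≤ n := by
  by_contra hcon
  have h1 := hs.ge (nextVal c d i - 1) (by omega)
  have h2 := hs.prev hb hi
  have h3 := hb.le i (by omega)
  omega

theorem IsStage.lt_of_lt (hb : IsBranching n c a) (hs : IsStage n c a β d) {i l : Fin k}
    (hi : d i < a i) (hl : d l < a l) (h : c l < c i) : nextVal c d l < nextVal c d i - 1 := by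
  apply hs.mono.lt_iff_lt.1
  rw [hs.prev hb hi, hs.next l hl]
  rcases hb.sep i l (by omega) (by omega) (by rintro rfl; omega) with h | h <;> omega

theorem IsBranching.ne (hb : IsBranching n c a) {i l : Fin k} (hi : 0 < a i) (hl : 0 < a l)
    (h : i ≠ l) : c i ≠ c l := by
  rcases hb.sep i l hi hl h with h | h <;> omega

theorem IsStage.step (hb : IsBranching n c a) (hs : IsStage n c a β d) {i : Fin k}
    (hi : d i < a i) :
    IsStage n c a (stepBars β (nextVal c d i)) (Function.update d i (d i + 1)) := by
  have hp := hs.prev hb hi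
  have hx := hs.next i hi
  have h0 := hs.nextVal_nonneg hb hi
  have hn := hs.nextVal_le hb hi
  have hsum : ∑ j, Function.update d i (d i + 1) j = ∑ j, d j + 1 := by
    rw [sum_update_succ, if_pos (Finset.mem_univ _)]
  refine ⟨stepBars_strictMono hs.mono _, ?_, ?_, ?_, ?_, ?_⟩
  · intro y
    have h1 : y ∈ Set.range (stepBars β (nextVal c d i)) ↔
        y ∈ Set.range β ∧ y ≠ c i - 1 - d i ∧ y ≠ c i + d i := by
      constructor
      · rintro ⟨j, rfl⟩
        rw [← hp, ← hx]
        simp only [stepBars]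
        split_ifs with h <;>
          exact ⟨⟨_, rfl⟩, hs.mono.injective.ne (by omega), hs.mono.injective.ne (by omega)⟩
      · rintro ⟨h1, h2, h3⟩
        rcases mem_range_stepBars (nextVal c d i) y h1 with h | h | h
        · exact h
        · exact absurd (h.trans hp) h2
        · exact absurd (h.trans hx) h3
    rw [h1, hs.range]
    constructor
    · rintro ⟨h2, h3, h4⟩ j
      have h5 := h2 j
      by_cases hj : j = i
      · subst hj
        rw [Function.update_self]
        push_cast
        omega
      · rwa [Function.update_of_ne hj]
    · intro h
      have h2 := h i
      rw [Function.update_self] at h2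
      push_cast at h2
      refine ⟨fun j => ?_, by omega, by omega⟩
      by_cases hj : j = i
      · subst hj; omega
      · have := h j
        rwa [Function.update_of_ne hj] at this
  · intro j hj
    rw [stepBars, if_pos (by omega), hs.neg _ (by omega), hsum]
    push_cast
    ring
  · intro j hj
    rw [stepBars, if_neg (by omega), hs.ge _ (by omega), hsum]
    push_cast
    ring
  · intro j
    by_cases hj : j = i
    · subst hj
      rw [Function.update_self]
      omega
    · rw [Function.update_of_ne hj]
      exact hs.le j
  · intro l hl
    rw [nextVal_update]
    by_cases h : l = i
    · subst h
      rw [Function.update_self] at hl ⊢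
      simp only [lt_irrefl, if_false, sub_zero, add_zero]
      rw [stepBars, if_neg (lt_irrefl _)]
      -- The point just outside the new arc is still free, so it is the strand following `nextVal c
      -- d l`, which inherits that number.
      have h1 : c l + (d l + 1 : ℕ) ∈ Set.range β := by
        rw [hs.range]
        intro j
        by_cases hj : j = l
        · subst hj; push_cast; omega
        · have := hs.le j
          by_cases h0 : 0 < a j
          · rcases hb.sep l j (by omega) h0 (Ne.symm hj) with h | h <;> omega
          · omega
      obtain ⟨w, hw⟩ := h1
      have h2 : nextVal c d l + 1 ≤ w := by
        have : nextVal c d l < w := hs.mono.lt_iff_lt.1 (by omega)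
        omega
      have h3 := hs.mono.monotone h2
      have h4 := hs.mono (show nextVal c d l < nextVal c d l + 1 by omega)
      omega
    · rw [Function.update_of_ne h] at hl ⊢
      have hcne := hb.ne (i := l) (l := i) (by omega) (by omega) h
      by_cases hlt : c l < c i
      · have := hs.lt_of_lt hb hi hl hlt
        rw [if_neg (by omega), if_pos hlt, stepBars, if_pos (by omega), ← hs.next l hl]
        congr 1
        ring
      · have := hs.lt_of_lt hb hl hi (by omega)
        rw [if_pos (by omega), if_neg hlt, stepBars, if_neg (by omega), ← hs.next l hl]
        congr 1
        ring

/-- Joined strands are neighbours, so no free point may lie under the new arc: its ends enclose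
those of the next arc around `c i` and hence equal them. -/
theorem IsStage.eq_nextVal (hs : IsStage n c a β d) {v : ℤ} {i : Fin k}
    {e : ℕ} (he : e < a i) (h1 : β (v - 1) = c i - 1 - e) (h2 : β v = c i + e) :
    d i < a i ∧ v = nextVal c d i := by
  have h3 := (hs.range (β v)).1 ⟨v, rfl⟩ i
  have h4 : d i < a i := by omega
  have h5 := hs.next i h4
  refine ⟨h4, ?_⟩
  have h6 : v - 1 < nextVal c d i := hs.mono.lt_iff_lt.1 (by omega)
  have h7 : nextVal c d i ≤ v := hs.mono.le_iff_le.1 (by omega)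
  omega

end Stage

/-! ### Summation over all sequences -/

section Sum

variable {n : ℕ}

open Classical in
/-- The generating function of the sequences whose arcs satisfy `R`. -/
def seqSum (n : ℕ) (R : ℤ → ℤ → Prop) (r : ℕ) (β : ℤ → ℤ) : ℤ[T;T⁻¹] :=
  ∑ b : Fin r → Fin (n + 1), if GoodSeq R β b then T (2 * (weight b : ℤ)) else 0

theorem weight_cons {r : ℕ} (v : Fin (n + 1)) (b : Fin r → Fin (n + 1)) :
    weight (Fin.cons v b : Fin (r + 1) → Fin (n + 1)) = v + weight b := by
  simp [weight, Fin.sum_univ_succ]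

open Classical in
theorem seqSum_succ (R : ℤ → ℤ → Prop) (r : ℕ) (β : ℤ → ℤ) :
    seqSum n R (r + 1) β = ∑ v : Fin (n + 1), if R (β (v - 1)) (β v) then
      T (2 * (v : ℤ)) * seqSum n R r (stepBars β v) else 0 := by
  rw [seqSum, ← (Fin.consEquiv fun _ => Fin (n + 1)).sum_comp, Fintype.sum_prod_type]
  refine Finset.sum_congr rfl fun v _ => ?_
  simp only [Fin.consEquiv, Equiv.coe_fn_mk, goodSeq_cons, weight_cons]
  split_ifs with h
  · rw [seqSum, Finset.mul_sum]
    refine Finset.sum_congr rfl fun b _ => ?_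
    by_cases h' : GoodSeq R (stepBars β v) b
    · rw [if_pos ⟨h, h'⟩, if_pos h', ← T_add]
      push_cast
      rw [mul_add]
    · rw [if_neg (fun h => h' h.2), if_neg h', mul_zero]
  · exact Finset.sum_eq_zero fun b _ => if_neg fun h' => h h'.1

theorem toLex_cons_le {r : ℕ} {v v' : Fin (n + 1)} {b b' : Fin r → Fin (n + 1)}
    (h : v < v' ∨ (v = v' ∧ toLex b ≤ toLex b')) :
    toLex (Fin.cons v b : Fin (r + 1) → Fin (n + 1)) ≤ toLex (Fin.cons v' b') := by
  rcases h with h | ⟨rfl, h⟩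
  · exact le_of_lt ⟨0, fun j hj => absurd hj (Fin.not_lt_zero j), h⟩
  · rcases h.eq_or_lt with h | ⟨i, h1, h2⟩
    · rw [toLex_inj.1 h]
    · refine le_of_lt ⟨i.succ, fun j hj => ?_, h2⟩
      refine Fin.cases (fun _ => rfl) (fun j hj => ?_) j hj
      exact h1 j (Fin.succ_lt_succ_iff.1 hj)

variable {k : ℕ} (c : Fin k → ℤ) (a : Fin k → ℕ)

/-- The largest weight of a sequence that completes the stage `d`. -/
def maxWeight (d : Fin k → ℕ) : ℤ :=
  ∑ i, ((a i : ℤ) - d i) * (c i - (∑ j with c j < c i, d j : ℕ) + (∑ j with c i < c j, a j : ℕ))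

variable {c a}

/-- Serving centre `i` ahead of the missing arcs on its right costs one for the new arc, whose value
is not yet raised by them, and one for each of them, whose value is lowered by the new arc. Hence
the factor `2`. -/
theorem maxWeight_update (d : Fin k → ℕ) (i : Fin k) :
    maxWeight c a d = nextVal c d i + maxWeight c a (Function.update d i (d i + 1)) +
      2 * ∑ j with c i < c j, ((a j : ℤ) - d j) := by
  have h1 : ∀ j, ((Function.update d i (d i + 1) j : ℕ) : ℤ) = d j + if j = i then 1 else 0 := by
    intro j
    by_cases h : j = i
    · subst h; simp
    · simp [h]
  have h2 : maxWeight c a d - maxWeight c a (Function.update d i (d i + 1)) =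
      ∑ j, ((if j = i then (c j - (∑ l with c l < c j, d l : ℕ) +
        (∑ l with c j < c l, a l : ℕ)) else 0) +
        (if c i < c j then ((a j : ℤ) - d j) else 0)) := by
    rw [maxWeight, maxWeight, ← Finset.sum_sub_distrib]
    refine Finset.sum_congr rfl fun j _ => ?_
    rw [h1, sum_update_succ]
    simp only [Finset.mem_filter, Finset.mem_univ, true_and]
    by_cases hj : j = i
    · subst hj
      simp
      ring
    · by_cases hc : c i < c j
      · simp [hj, hc]; ring
      · simp [hj, hc]
  rw [Finset.sum_add_distrib, Finset.sum_ite_eq', if_pos (Finset.mem_univ _),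
    ← Finset.sum_filter] at h2
  rw [sub_eq_iff_eq_add.1 h2, nextVal, Finset.sum_sub_distrib]
  push_cast
  ring

/-- Induction on the remaining rows. The first row chooses an unfinished centre; by
`maxWeight_update` the choice multiplies the top power by `T (-4)` once for each missing arc further
right, which is the weight in `qMultinomial_rec`. -/
theorem seqSum_isStage {R : ℤ → ℤ → Prop} (hb : IsBranching n c a)
    (hR : ∀ x y, x < y → (R x y ↔ ∃ i, ∃ e : ℕ, e < a i ∧ x = c i - 1 - e ∧ y = c i + e))
    (r : ℕ) (β : ℤ → ℤ) (d : Fin k → ℕ) (hs : IsStage n c a β d) (hr : ∑ i, (a i - d i) = r) :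
    seqSum n R r β = T (2 * maxWeight c a d) *
      Polynomial.aeval (T (-4) : ℤ[T;T⁻¹]) (qMultinomial fun i => a i - d i) ∧
    ∃ bM : Fin r → Fin (n + 1), GoodSeq R β bM ∧ (weight bM : ℤ) = maxWeight c a d ∧
      ∀ b : Fin r → Fin (n + 1), GoodSeq R β b → toLex b ≤ toLex bM := by
  classical
  induction r generalizing β d with
  | zero =>
    have hd : ∀ i, a i = d i := fun i => by
      have := Finset.sum_eq_zero_iff.1 hr i (Finset.mem_univ i)
      have := hs.le i
      omega
    have hW : maxWeight c a d = 0 := by simp [maxWeight, hd]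
    refine ⟨?_, Fin.elim0, fun t => t.elim0, ?_, fun b _ => ?_⟩
    · rw [qMultinomial_zero hr, hW]
      simp [seqSum, GoodSeq, weight]
    · simp [hW, weight]
    · rw [Subsingleton.elim b Fin.elim0]
  | succ r ih =>
    have hR' : ∀ v : ℤ, R (β (v - 1)) (β v) ↔ ∃ i, d i < a i ∧ v = nextVal c d i := by
      intro v
      rw [hR _ _ (hs.mono (by omega))]
      constructor
      · rintro ⟨i, e, he, h1, h2⟩
        exact ⟨i, hs.eq_nextVal he h1 h2⟩
      · rintro ⟨i, hi, rfl⟩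
        exact ⟨i, d i, hi, hs.prev hb hi, hs.next i hi⟩
    have hrec : ∀ i, d i < a i → ∑ j, (a j - Function.update d i (d i + 1) j) = r := by
      intro i hi
      have h1 := Finset.add_sum_erase Finset.univ (fun j => a j - d j) (Finset.mem_univ i)
      have h2 := Finset.add_sum_erase Finset.univ
        (fun j => a j - Function.update d i (d i + 1) j) (Finset.mem_univ i)
      have h3 : ∑ j ∈ Finset.univ.erase i, (a j - Function.update d i (d i + 1) j) =
          ∑ j ∈ Finset.univ.erase i, (a j - d j) := Finset.sum_congr rfl fun j hj => by
        rw [Function.update_of_ne (Finset.ne_of_mem_erase hj)]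
      simp only [Function.update_self] at h1 h2
      omega
    have ih' := fun i hi => ih _ _ (hs.step hb (i := i) hi) (hrec i hi)
    have hval : ∀ i, d i < a i → ∃ v : Fin (n + 1), ((v : ℕ) : ℤ) = nextVal c d i := by
      intro i hi
      have h1 := hs.nextVal_nonneg hb hi
      have h2 := hs.nextVal_le hb hi
      exact ⟨⟨(nextVal c d i).toNat, by omega⟩, by simp only; omega⟩
    have hinj : ∀ i, d i < a i → ∀ j, d j < a j → nextVal c d i = nextVal c d j → i = j := by
      intro i hi j hj h
      by_contra hne
      have := hb.ne (by omega) (by omega) hne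
      rcases lt_or_gt_of_ne this with h1 | h1
      · have := hs.lt_of_lt hb hj hi h1; omega
      · have := hs.lt_of_lt hb hi hj h1; omega
    constructor
    · have h1 : seqSum n R (r + 1) β = ∑ i, if d i < a i then T (2 * nextVal c d i) *
          seqSum n R r (stepBars β (nextVal c d i)) else 0 := by
        rw [seqSum_succ, ← Finset.sum_filter, ← Finset.sum_filter]
        symm
        refine Finset.sum_bij (fun i hi => (hval i (Finset.mem_filter.1 hi).2).choose)
          ?_ ?_ ?_ ?_
        · intro i hi
          have hv := (hval i (Finset.mem_filter.1 hi).2).choose_spec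
          exact Finset.mem_filter.2 ⟨Finset.mem_univ _,
            (hR' _).2 ⟨i, (Finset.mem_filter.1 hi).2, hv⟩⟩
        · intro i hi j hj h
          have hv := (hval i (Finset.mem_filter.1 hi).2).choose_spec
          have hv' := (hval j (Finset.mem_filter.1 hj).2).choose_spec
          rw [h, hv'] at hv
          exact hinj i (Finset.mem_filter.1 hi).2 j (Finset.mem_filter.1 hj).2 hv.symm
        · intro v hv
          obtain ⟨i, hi, hvi⟩ := (hR' _).1 (Finset.mem_filter.1 hv).2
          refine ⟨i, Finset.mem_filter.2 ⟨Finset.mem_univ _, hi⟩, Fin.ext ?_⟩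
          have := (hval i hi).choose_spec
          omega
        · intro i hi
          have hv := (hval i (Finset.mem_filter.1 hi).2).choose_spec
          simp only [hv]
      rw [h1, qMultinomial_rec c (fun i => a i - d i) (by omega) ?_
        (fun i j => a j - Function.update d i (d i + 1) j) ?_, map_sum, Finset.mul_sum]
      · refine Finset.sum_congr rfl fun i _ => ?_
        by_cases hi : d i < a i
        · rw [if_pos hi, if_pos (by omega), (ih' i hi).1, map_mul, map_pow, Polynomial.aeval_X,
            T_pow, ← mul_assoc, ← mul_assoc, ← T_add, ← T_add, maxWeight_update d i]
          congr 2
          have : ((∑ j with c i < c j, (a j - d j) : ℕ) : ℤ) =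
              ∑ j with c i < c j, ((a j : ℤ) - d j) := by
            push_cast
            exact Finset.sum_congr rfl fun j _ => Nat.cast_sub (hs.le j)
          rw [this]
          ring
        · rw [if_neg hi, if_neg (by omega), map_zero, mul_zero]
      · intro i j hij hi hj
        exact hb.ne (by omega) (by omega) hij
      · intro i hi
        funext j
        by_cases hj : j = i
        · subst hj; simp only [Function.update_self]; omega
        · simp only [Function.update_of_ne hj]
    -- Next values increase with the centre, so the rightmost unfinished centre gives the largest
    -- first entry; no arcs are missing on its right, so the maximal weight is attained too.
    · obtain ⟨i, hi, hmax⟩ : ∃ i, d i < a i ∧ ∀ j, d j < a j → c j ≤ c i := by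
        have hne : (Finset.univ.filter fun i => d i < a i).Nonempty := by
          rw [Finset.filter_nonempty_iff]
          by_contra hcon
          push Not at hcon
          have : ∑ i, (a i - d i) = 0 := Finset.sum_eq_zero fun i hi => by
            have := hcon i hi; omega
          omega
        obtain ⟨i, hi, hmax⟩ := Finset.exists_max_image _ c hne
        exact ⟨i, (Finset.mem_filter.1 hi).2, fun j hj =>
          hmax j (Finset.mem_filter.2 ⟨Finset.mem_univ _, hj⟩)⟩
      obtain ⟨-, bM, hg, hw, hlex⟩ := ih' i hi
      obtain ⟨v, hv⟩ := hval i hi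
      refine ⟨Fin.cons v bM, goodSeq_cons.2 ⟨(hR' _).2 ⟨i, hi, hv⟩, by rwa [hv]⟩, ?_, ?_⟩
      · rw [weight_cons, maxWeight_update d i, Finset.sum_eq_zero, ← hw, ← hv]
        · push_cast; ring
        · intro j hj
          have h1 := (Finset.mem_filter.1 hj).2
          have h2 : ¬ d j < a j := fun h => by have := hmax j h; omega
          have := hs.le j
          omega
      · intro b hgb
        rw [← Fin.cons_self_tail b] at hgb ⊢
        obtain ⟨h1, h2⟩ := goodSeq_cons.1 hgb
        obtain ⟨l, hl, hvl⟩ := (hR' _).1 h1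
        apply toLex_cons_le
        by_cases hli : l = i
        · subst hli
          have : b 0 = v := Fin.ext (by omega)
          rw [hvl] at h2
          exact Or.inr ⟨this, hlex _ h2⟩
        · have h3 := hb.ne (by omega) (by omega) hli
          have h4 := hmax l hl
          have h5 := hs.lt_of_lt hb hi hl (by omega)
          left
          rw [Fin.lt_def]
          omega

end Sum

/-! ### Arcs and regions -/

/-- The first end, in clockwise order, of an arc without ends on the floor. -/
def CatalanState.IsOpening (C : CatalanState m n) (p : BdPt m n) : Prop :=
  C.IsUpper p ∧ p.pos < (C.mate p).pos

/-- The arc that ends in `p` separates the boundary interval `g` from the floor. -/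
def CatalanState.Encloses (C : CatalanState m n) (p : BdPt m n) (g : ℕ) : Prop :=
  p.pos < g ∧ g ≤ (C.mate p).pos

/-- The region next to a boundary interval. -/
def CatalanState.regionAt (C : CatalanState m n) (g : BdInterval m n) : C.Region :=
  Quotient.mk C.regionSetoid g

theorem BdPt.exists_pos {x : ℕ} (h : x < 2 * m + n) : ∃ p : BdPt m n, p.pos = x ∧ ¬ p.OnFloor := by
  obtain ⟨p, hp, hpf⟩ := BdPt.exists_coord (m := m) (n := n) (x := (x : ℤ) - m)
    (by omega) (by omega)
  refine ⟨p, ?_, hpf⟩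
  simp only [BdPt.coord] at hp
  omega

theorem BdPt.coord_bounds {p : BdPt m n} (h1 : ¬ p.OnFloor) (h2 : p.level ≤ 1) :
    -1 ≤ p.coord ∧ p.coord ≤ n := by
  rcases p with j | j | i | i
  · rw [BdPt.coord_top]; omega
  · exact absurd trivial h1
  · rw [BdPt.coord_left]; simp only [BdPt.level] at h2; omega
  · rw [BdPt.coord_right]; simp only [BdPt.level] at h2; omega

theorem BdPt.onFloor_iff_pos (p : BdPt m n) : p.OnFloor ↔ 2 * m + n ≤ p.pos := by
  rw [BdPt.onFloor_iff, BdPt.coord]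
  omega

section Region

variable {C : CatalanState m n}

theorem regionAt_eq_iff {g g' : BdInterval m n} :
    C.regionAt g = C.regionAt g' ↔
      ∀ p, C.IsUpper p → (C.Encloses p g ↔ C.Encloses p g') :=
  Quotient.eq (r := C.regionSetoid)

/-- Another arc encloses both ends of the arc at `p` or none of them. -/
theorem CatalanState.IsOpening.lt_and_lt_iff {p q : BdPt m n} (hp : C.IsOpening p) (h1 : q ≠ p)
    (h2 : q ≠ C.mate p) :
    (q.pos < (C.mate p).pos ∧ (C.mate p).pos < (C.mate q).pos) ↔
      (q.pos < p.pos ∧ p.pos < (C.mate q).pos) := by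
  have h3 := BdPt.pos_injective.ne h1
  have h4 := BdPt.pos_injective.ne h2
  have h5 := C.noncrossing p q
  have h6 := C.noncrossing q p
  have h7 : (C.mate q).pos ≠ p.pos := BdPt.pos_injective.ne fun h => h2 (by
    rw [← h, C.mate_mate])
  have h8 : (C.mate q).pos ≠ (C.mate p).pos := BdPt.pos_injective.ne fun h => h1 (by
    rw [← C.mate_mate q, h, C.mate_mate])
  have := hp.2
  omega

theorem CatalanState.mate_pos_ne (C : CatalanState m n) {p q : BdPt m n} (h : q ≠ p) :
    (C.mate q).pos ≠ (C.mate p).pos :=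
  BdPt.pos_injective.ne fun h' => h (by rw [← C.mate_mate q, h', C.mate_mate])

theorem CatalanState.mate_pos_ne' (C : CatalanState m n) {p q : BdPt m n} (h : q ≠ C.mate p) :
    (C.mate q).pos ≠ p.pos :=
  BdPt.pos_injective.ne fun h' => h (by rw [← h', C.mate_mate])

theorem CatalanState.IsOpening.before_mate {p : BdPt m n} (hp : C.IsOpening p) :
    C.before (C.mate p) = C.after p := by
  refine regionAt_eq_iff.2 ?_
  intro q _
  have h0 := hp.2
  simp only [CatalanState.Encloses]
  by_cases h1 : q = p
  · subst h1; omega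
  by_cases h2 : q = C.mate p
  · subst h2; rw [C.mate_mate]; omega
  have := hp.lt_and_lt_iff h1 h2
  have := C.mate_pos_ne h1
  have := C.mate_pos_ne' h2
  have := BdPt.pos_injective.ne h1
  omega

theorem CatalanState.IsOpening.after_mate {p : BdPt m n} (hp : C.IsOpening p) :
    C.after (C.mate p) = C.before p := by
  refine regionAt_eq_iff.2 ?_
  intro q _
  have h0 := hp.2
  simp only [CatalanState.Encloses]
  by_cases h1 : q = p
  · subst h1; omega
  by_cases h2 : q = C.mate p
  · subst h2; rw [C.mate_mate]; omega
  have := hp.lt_and_lt_iff h1 h2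
  have := C.mate_pos_ne h1
  have := C.mate_pos_ne' h2
  have := BdPt.pos_injective.ne h1
  have := BdPt.pos_injective.ne h2
  omega

theorem CatalanState.IsOpening.encloses_of_eq_after {p : BdPt m n} (hp : C.IsOpening p)
    {g : BdInterval m n} (h : C.regionAt g = C.after p) : C.Encloses p g :=
  (regionAt_eq_iff.1 h p hp.1).2 ⟨Nat.lt_succ_self _, hp.2⟩

theorem CatalanState.IsOpening.before_ne_after {p : BdPt m n} (hp : C.IsOpening p) :
    C.before p ≠ C.after p := fun h =>
  lt_irrefl _ (hp.encloses_of_eq_after h).1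

theorem CatalanState.IsOpening.root_ne_after {p : BdPt m n} (hp : C.IsOpening p) :
    C.root ≠ C.after p := fun h => by
  have h1 := (hp.encloses_of_eq_after h).2
  have h2 := (C.mate p).pos_lt
  simp only [Fin.val_last] at h1
  omega

/-- An arc encloses every boundary interval of the region just inside it, so the interval after its
opening end is the first of that region and determines the arc. -/
theorem CatalanState.IsOpening.eq_of_after_eq {p q : BdPt m n} (hp : C.IsOpening p)
    (hq : C.IsOpening q) (h : C.after p = C.after q) : p = q := by
  have h1 := (hp.encloses_of_eq_after h.symm).1
  have h2 := (hq.encloses_of_eq_after h).1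
  simp only at h1 h2
  exact BdPt.pos_injective (by omega)

theorem CatalanState.IsUpper.isOpening_or {p : BdPt m n} (hp : C.IsUpper p) :
    C.IsOpening p ∨ C.IsOpening (C.mate p) := by
  have := BdPt.pos_injective.ne (C.mate_ne p)
  rcases lt_or_gt_of_ne this with h | h
  · exact Or.inr ⟨hp.mate, by rwa [C.mate_mate]⟩
  · exact Or.inl ⟨hp, h⟩

theorem CatalanState.tree_adj_iff {v w : C.Region} :
    C.tree.Adj v w ↔ ∃ p, C.IsOpening p ∧
      ((v = C.before p ∧ w = C.after p) ∨ (v = C.after p ∧ w = C.before p)) := by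
  constructor
  · rintro ⟨-, p, hp, h⟩
    rcases hp.isOpening_or with ho | ho
    · exact ⟨p, ho, h⟩
    · refine ⟨C.mate p, ho, ?_⟩
      rw [← ho.before_mate, ← ho.after_mate, C.mate_mate]
      exact h.symm
  · rintro ⟨p, hp, h⟩
    refine ⟨?_, p, hp.1, h⟩
    rcases h with ⟨rfl, rfl⟩ | ⟨rfl, rfl⟩
    · exact hp.before_ne_after
    · exact hp.before_ne_after.symm

theorem CatalanState.before_eq_after {p q : BdPt m n} (h : q.pos = p.pos + 1) :
    C.before q = C.after p := by
  rw [CatalanState.before, CatalanState.after]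
  congr 1
  exact Fin.ext h

/-- Points between the ends of an arc without ends on the floor. -/
theorem CatalanState.IsOpening.inside {p q : BdPt m n} (hp : C.IsOpening p) (h1 : p.pos < q.pos)
    (h2 : q.pos < (C.mate p).pos) :
    C.IsUpper q ∧ p.pos < (C.mate q).pos ∧ (C.mate q).pos < (C.mate p).pos := by
  have h3 := mt (BdPt.onFloor_iff_pos _).2 hp.1.2
  have hqp : q ≠ p := by rintro rfl; omega
  have hqm : q ≠ C.mate p := by rintro rfl; omega
  have h4 := hp.lt_and_lt_iff hqp hqm
  have h5 := C.mate_pos_ne hqp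
  have h6 := C.mate_pos_ne' hqm
  have h7 := hp.lt_and_lt_iff (q := C.mate q) (fun h => hqm (by rw [← h, C.mate_mate]))
    (fun h => hqp (by rw [← C.mate_mate q, h, C.mate_mate]))
  rw [C.mate_mate] at h7
  refine ⟨⟨?_, ?_⟩, ?_⟩
  · rw [BdPt.onFloor_iff_pos]; omega
  · rw [BdPt.onFloor_iff_pos]; omega
  · omega

end Region

/-! ### Trees that are wedges of paths -/

section Wedge

variable {k : ℕ} {a : Fin k → ℕ}

/-- The neighbour of a vertex of a wedge of paths in the direction of the root. -/
def wedgeParent (y : Σ i, Fin (a i)) : Option (Σ i, Fin (a i)) :=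
  if (y.2 : ℕ) = 0 then none else some ⟨y.1, ⟨y.2 - 1, by omega⟩⟩

theorem wedgeParent_eq_some {y z : Σ i, Fin (a i)} (h : wedgeParent y = some z) :
    z.1 = y.1 ∧ (y.2 : ℕ) = z.2 + 1 := by
  unfold wedgeParent at h
  split_ifs at h with h0
  obtain rfl := Option.some_injective _ h
  exact ⟨rfl, by simp only; omega⟩

theorem sigma_ext {y z : Σ i, Fin (a i)} (h1 : y.1 = z.1) (h2 : (y.2 : ℕ) = z.2) : y = z := by
  obtain ⟨i, j⟩ := y
  obtain ⟨i', j'⟩ := z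
  obtain rfl : i = i' := h1
  rw [show j = j' from Fin.ext h2]

theorem wedge_adj_parent (y : Σ i, Fin (a i)) :
    (wedgeOfPaths a).Adj (wedgeParent y) (some y) := by
  rw [wedgeOfPaths, SimpleGraph.fromRel_adj]
  by_cases h : (y.2 : ℕ) = 0
  · rw [wedgeParent, if_pos h]
    exact ⟨by simp, Or.inl h⟩
  · rw [wedgeParent, if_neg h]
    refine ⟨fun hy => ?_, Or.inl ⟨rfl, by simp only; omega⟩⟩
    have := congrArg (fun z : Σ i, Fin (a i) => (z.2 : ℕ)) (Option.some_injective _ hy)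
    simp only at this
    omega

end Wedge

section Branch

variable {C : CatalanState m n} {k : ℕ} {a : Fin k → ℕ} (φ : C.tree ≃g wedgeOfPaths a)
  (hφ : φ C.root = none)

include hφ

/-- Each edge is an arc, and the point is its direction: the inner side is away from the root. At
the first edge this holds because the root is inside no arc; later, a reversed edge would be the
previous arc, by `eq_of_after_eq`, and that arc already leads to the parent. -/
theorem exists_isOpening (i : Fin k) (j : ℕ) (hj : j < a i) :
    ∃ p, C.IsOpening p ∧ φ (C.after p) = some ⟨i, j, hj⟩ ∧
      φ (C.before p) = wedgeParent ⟨i, j, hj⟩ := by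
  induction j with
  | zero =>
    have h1 := φ.symm.map_rel_iff.2 (wedge_adj_parent (a := a) ⟨i, 0, hj⟩)
    obtain ⟨p, hp, ⟨h2, h3⟩ | ⟨h2, h3⟩⟩ := CatalanState.tree_adj_iff.1 h1
    · exact ⟨p, hp, by rw [← h3]; simp, by rw [← h2]; simp⟩
    · exfalso
      apply hp.root_ne_after
      rw [← h2]
      apply φ.injective
      rw [hφ]
      simp [wedgeParent]
  | succ j ih =>
    obtain ⟨p₀, hp₀, h4, h5⟩ := ih (by omega)
    have h1 := φ.symm.map_rel_iff.2 (wedge_adj_parent (a := a) ⟨i, j + 1, hj⟩)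
    obtain ⟨p, hp, ⟨h2, h3⟩ | ⟨h2, h3⟩⟩ := CatalanState.tree_adj_iff.1 h1
    · exact ⟨p, hp, by rw [← h3]; simp, by rw [← h2]; simp⟩
    · exfalso
      have h6 : p = p₀ := by
        apply hp.eq_of_after_eq hp₀
        rw [← h2]
        apply φ.injective
        rw [h4]
        simp [wedgeParent]
      subst h6
      rw [← h3] at h5
      have h7 := wedgeParent_eq_some (h5.symm.trans (φ.apply_symm_apply _))
      simp only at h7
      omega

/-- The arcs of `C` without ends on the floor form nested families around some centres. -/
theorem exists_centres (hd : ∀ (v : C.Region) (d : ℕ), C.IsDelay v d → d = 1) :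
    ∃ c : Fin k → ℤ, IsBranching n c a ∧ ∀ x y, x < y →
      (C.Arc x y ↔ ∃ i, ∃ e : ℕ, e < a i ∧ x = c i - 1 - e ∧ y = c i + e) := by
  have hex := fun y : Σ i, Fin (a i) => exists_isOpening φ hφ y.1 y.2 y.2.2
  choose P hP hPa hPb using hex
  have hsurj : ∀ q, C.IsOpening q → ∃ y, q = P y := by
    intro q hq
    cases h : φ (C.after q) with
    | none =>
      rw [← hφ] at h
      exact absurd (φ.injective h).symm hq.root_ne_after
    | some y => exact ⟨y, hq.eq_of_after_eq (hP y) (φ.injective (h.trans (hPa y).symm))⟩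
  -- the arc inside a given arc
  have hchild : ∀ y q, C.IsOpening q → C.before q = C.after (P y) →
      ∃ h : (y.2 : ℕ) + 1 < a y.1, q = P ⟨y.1, _, h⟩ := by
    intro y q hq h
    obtain ⟨z, rfl⟩ := hsurj q hq
    have h1 : wedgeParent z = some y := by
      rw [← hPa y, ← h]
      exact (hPb z).symm
    obtain ⟨h2, h3⟩ := wedgeParent_eq_some h1
    have h4 : (y.2 : ℕ) + 1 < a y.1 := by
      have h4 := z.2.2
      have h5 := congrArg a h2
      omega
    exact ⟨h4, congrArg P (sigma_ext h2.symm h3)⟩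
  -- If the arc at `P y` has points under it, the first one opens and the last one closes an arc
  -- directly inside. A vertex of a path has only one child, so both are ends of the same arc.
  have hnext : ∀ y, (C.mate (P y)).pos ≠ (P y).pos + 1 → ∃ h : (y.2 : ℕ) + 1 < a y.1,
      (P ⟨y.1, _, h⟩).pos = (P y).pos + 1 ∧
        (C.mate (P ⟨y.1, _, h⟩)).pos + 1 = (C.mate (P y)).pos := by
    intro y hy
    have h0 := (hP y).2
    have h1 := mt (BdPt.onFloor_iff_pos _).2 (hP y).1.2
    obtain ⟨q, hq, -⟩ := BdPt.exists_pos (m := m) (n := n) (x := (P y).pos + 1) (by omega)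
    obtain ⟨q', hq', -⟩ := BdPt.exists_pos (m := m) (n := n) (x := (C.mate (P y)).pos - 1)
      (by omega)
    have h2 := (hP y).inside (q := q) (by omega) (by omega)
    have h3 := (hP y).inside (q := q') (by omega) (by omega)
    have h4 := BdPt.pos_injective.ne (C.mate_ne q)
    have h5 := BdPt.pos_injective.ne (C.mate_ne q')
    have ho : C.IsOpening q := ⟨h2.1, by omega⟩
    have ho' : C.IsOpening (C.mate q') := ⟨h3.1.mate, by rw [C.mate_mate]; omega⟩
    obtain ⟨h, rfl⟩ := hchild y q ho (CatalanState.before_eq_after hq)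
    obtain ⟨_, h7⟩ := hchild y (C.mate q') ho' (by
      rw [← ho'.after_mate, C.mate_mate, ← (hP y).before_mate]
      exact (CatalanState.before_eq_after (by omega)).symm)
    refine ⟨h, hq, ?_⟩
    rw [← h7, C.mate_mate]
    omega
  have hinner : ∀ i j, ∀ h : j + 1 < a i,
      (P ⟨i, j + 1, h⟩).pos = (P ⟨i, j, by omega⟩).pos + 1 ∧
        (C.mate (P ⟨i, j + 1, h⟩)).pos + 1 = (C.mate (P ⟨i, j, by omega⟩)).pos := by
    intro i j h
    have h1 : C.before (P ⟨i, j + 1, h⟩) = C.after (P ⟨i, j, by omega⟩) := by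
      apply φ.injective
      rw [hPa, hPb]
      rfl
    have h2 := (hP ⟨i, j, by omega⟩).encloses_of_eq_after h1
    have h3 : (C.mate (P ⟨i, j, by omega⟩)).pos ≠ (P ⟨i, j, by omega⟩).pos + 1 := by
      intro h3
      simp only [CatalanState.Encloses] at h2
      have h4 : P ⟨i, j + 1, h⟩ = C.mate (P ⟨i, j, by omega⟩) := BdPt.pos_injective (by omega)
      have h5 := (hP ⟨i, j + 1, h⟩).2
      rw [h4, C.mate_mate] at h5
      omega
    obtain ⟨_, h4⟩ := hnext _ h3
    exact h4
  have hlast : ∀ i j, ∀ h : j < a i, j + 1 = a i →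
      (C.mate (P ⟨i, j, h⟩)).pos = (P ⟨i, j, h⟩).pos + 1 := by
    intro i j h h1
    by_contra h2
    obtain ⟨h3, -⟩ := hnext _ h2
    simp only at h3
    omega
  -- The centre is the right end of the innermost arc. The value `0` for an empty path is never
  -- used, as every condition on `c i` assumes `0 < a i`.
  let c : Fin k → ℤ := fun i => if h : 0 < a i then
    (C.mate (P ⟨i, a i - 1, by omega⟩)).coord else 0
  -- Here `e` counts from the innermost arc outwards, whereas positions on the path count from the
  -- root; hence the index `a i - 1 - e`.
  have hcoord : ∀ i (e : ℕ) (h : e < a i), (P ⟨i, a i - 1 - e, by omega⟩).coord = c i - 1 - e ∧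
      (C.mate (P ⟨i, a i - 1 - e, by omega⟩)).coord = c i + e := by
    intro i e h
    have hc : c i = (C.mate (P ⟨i, a i - 1, by omega⟩)).coord := dif_pos (by omega)
    induction e with
    | zero =>
      have := hlast i (a i - 1) (by omega) (by omega)
      simp only [BdPt.coord, Nat.sub_zero] at *
      omega
    | succ e ih =>
      have h1 := ih (by omega)
      have h2 := hinner i (a i - 1 - (e + 1)) (by omega)
      have h3 : (⟨i, a i - 1 - (e + 1) + 1, by omega⟩ : Σ i, Fin (a i)) =
          ⟨i, a i - 1 - e, by omega⟩ := sigma_ext rfl (by simp only; omega)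
      rw [h3] at h2
      simp only [BdPt.coord] at *
      omega
  have hArc : ∀ i (e : ℕ), e < a i → C.Arc (c i - 1 - e) (c i + e) := fun i e h =>
    ⟨_, (hP _).1, (hcoord i e h).1, (hcoord i e h).2⟩
  -- The region inside the innermost arc is a leaf, so delay `1` keeps both ends of that arc on the
  -- ceiling or at the top points of the sides, with coordinates from `-1` to `n`.
  have hdelay : ∀ i, ∀ h : 0 < a i, C.height (P ⟨i, a i - 1, by omega⟩) ≤ 1 := by
    intro i hi
    have hy := hP ⟨i, a i - 1, by omega⟩
    have h1 := hd (C.after (P ⟨i, a i - 1, by omega⟩)) _ ⟨⟨hy.root_ne_after.symm, ?_⟩, _, hy.1,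
      Or.inr rfl, rfl⟩
    · omega
    · rw [Set.ncard_eq_one]
      refine ⟨C.before (P ⟨i, a i - 1, by omega⟩), Set.ext fun w => ?_⟩
      rw [SimpleGraph.mem_neighborSet, CatalanState.tree_adj_iff, Set.mem_singleton_iff]
      constructor
      · rintro ⟨p, hp, ⟨h1, -⟩ | ⟨h1, rfl⟩⟩
        · obtain ⟨h2, -⟩ := hchild _ p hp h1.symm
          simp only at h2
          omega
        · rw [hy.eq_of_after_eq hp h1]
      · rintro rfl
        exact ⟨_, hy, Or.inr ⟨rfl, rfl⟩⟩
  refine ⟨c, ⟨?_, ?_, ?_⟩, ?_⟩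
  · intro i j hi hj hij
    by_contra hcon
    -- Within a family the arc at `z` ends at the mirror image of `z`. A point common to two
    -- families would force equal centres, hence equal innermost arcs.
    have hz : ∀ l z, c l - a l ≤ z → z < c l + a l → C.Arc z (2 * c l - 1 - z) := by
      intro l z h1 h2
      by_cases h3 : z < c l
      · obtain ⟨e, he⟩ := Int.eq_ofNat_of_zero_le (show 0 ≤ c l - 1 - z by omega)
        convert hArc l e (by omega) using 1 <;> omega
      · obtain ⟨e, he⟩ := Int.eq_ofNat_of_zero_le (show 0 ≤ z - c l by omega)
        convert (hArc l e (by omega)).symm using 1 <;> omega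
    obtain ⟨z, h1, h2, h3, h4⟩ : ∃ z, c i - a i ≤ z ∧ z < c i + a i ∧ c j - a j ≤ z ∧
        z < c j + a j := by
      refine ⟨max (c i - a i) (c j - a j), ?_⟩
      omega
    obtain ⟨p, -, hp, h5⟩ := hz i z h1 h2
    obtain ⟨q, -, hq, h6⟩ := hz j z h3 h4
    obtain rfl : p = q := BdPt.coord_injective (hp.trans hq.symm)
    have h7 := (hcoord i 0 hi).1
    have h8 := (hcoord j 0 hj).1
    have h9 : P ⟨i, a i - 1 - 0, by omega⟩ = P ⟨j, a j - 1 - 0, by omega⟩ :=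
      BdPt.coord_injective (by omega)
    have h10 := (hPa ⟨i, a i - 1 - 0, by omega⟩).symm.trans
      ((congrArg (fun p => φ (C.after p)) h9).trans (hPa _))
    exact hij (congrArg Sigma.fst (Option.some_injective _ h10))
  · intro i hi
    have h1 := hdelay i hi
    have h2 := (hcoord i 0 hi).1
    have h3 := BdPt.coord_bounds (hP ⟨i, a i - 1, by omega⟩).1.1 (le_of_max_le_left h1)
    simp only [Nat.sub_zero] at h2
    omega
  · intro i hi
    have h1 := hdelay i hi
    have h2 := (hcoord i 0 hi).2
    have h3 := BdPt.coord_bounds (hP ⟨i, a i - 1, by omega⟩).1.2 (le_of_max_le_right h1)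
    simp only [Nat.sub_zero] at h2
    omega
  · intro x y hxy
    constructor
    · rintro ⟨p, hp, rfl, rfl⟩
      have ho : C.IsOpening p := ⟨hp, by simp only [BdPt.coord] at hxy; omega⟩
      obtain ⟨⟨i, j⟩, rfl⟩ := hsurj p ho
      have h1 := hcoord i (a i - 1 - j) (by omega)
      have h2 : (⟨i, a i - 1 - (a i - 1 - j), by omega⟩ : Σ i, Fin (a i)) = ⟨i, j⟩ :=
        sigma_ext rfl (by simp only; omega)
      rw [h2] at h1
      exact ⟨i, a i - 1 - j, by omega, h1⟩
    · rintro ⟨i, e, he, rfl, rfl⟩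
      exact hArc i e he

end Branch

/-- The number of arcs without ends on the floor. -/
theorem sum_eq_of_isBranching {C : CatalanState m n} (hF : C.NoFloorReturns) {k : ℕ}
    {a : Fin k → ℕ} {c : Fin k → ℤ} (hb : IsBranching n c a)
    (hR : ∀ x y, x < y →
      (C.Arc x y ↔ ∃ i, ∃ e : ℕ, e < a i ∧ x = c i - 1 - e ∧ y = c i + e)) :
    ∑ i, a i = m := by
  have hinj : Function.Injective (fun j : Fin n => (C.mate (.bot j)).coord) := by
    intro i j h
    have := congrArg C.mate (BdPt.coord_injective h)
    rw [C.mate_mate, C.mate_mate] at this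
    injection this
  have hmem : ∀ i x, x ∈ Finset.Ico (c i - a i) (c i + a i) → ∃ y, C.Arc x y := by
    intro i x hx
    rw [Finset.mem_Ico] at hx
    by_cases h : x < c i
    · obtain ⟨e, he⟩ := Int.eq_ofNat_of_zero_le (show 0 ≤ c i - 1 - x by omega)
      exact ⟨c i + e, (hR _ _ (by omega)).2 ⟨i, e, by omega, by omega, rfl⟩⟩
    · obtain ⟨e, he⟩ := Int.eq_ofNat_of_zero_le (show 0 ≤ x - c i by omega)
      exact ⟨c i - 1 - e, ((hR _ _ (by omega)).2 ⟨i, e, by omega, rfl, by omega⟩).symm⟩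
  -- The `n + 2m` points off the floor are the `n` partners of the floor points and the `2 a i` ends
  -- in each family; comparing cardinalities gives the claim.
  have hset : Finset.Ico (-(m : ℤ)) (n + m) =
      Finset.univ.image (fun j : Fin n => (C.mate (.bot j)).coord) ∪
        Finset.univ.biUnion fun i => Finset.Ico (c i - a i) (c i + a i) := by
    ext x
    rw [Finset.mem_union, Finset.mem_image, Finset.mem_biUnion, Finset.mem_Ico]
    constructor
    · rintro ⟨h1, h2⟩
      obtain ⟨p, rfl, hpf⟩ := BdPt.exists_coord h1 h2
      by_cases hm : (C.mate p).OnFloor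
      · left
        cases hq : C.mate p with
        | bot j => exact ⟨j, Finset.mem_univ _, by rw [← hq, C.mate_mate]⟩
        | top j => rw [hq] at hm; exact hm.elim
        | left j => rw [hq] at hm; exact hm.elim
        | right j => rw [hq] at hm; exact hm.elim
      · right
        have hne := BdPt.coord_injective.ne (C.mate_ne p)
        have ha : C.Arc p.coord (C.mate p).coord := ⟨p, ⟨hpf, hm⟩, rfl, rfl⟩
        rcases lt_or_gt_of_ne hne with h | h
        · obtain ⟨i, e, he, h3, h4⟩ := (hR _ _ h).1 ha.symm
          exact ⟨i, Finset.mem_univ _, Finset.mem_Ico.2 (by omega)⟩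
        · obtain ⟨i, e, he, h3, h4⟩ := (hR _ _ h).1 ha
          exact ⟨i, Finset.mem_univ _, Finset.mem_Ico.2 (by omega)⟩
    · have key : ∀ p : BdPt m n, ¬ p.OnFloor → -(m : ℤ) ≤ p.coord ∧ p.coord < n + m :=
        fun p hp => ⟨p.neg_le_coord, not_le.1 (mt (BdPt.onFloor_iff _).2 hp)⟩
      rintro (⟨j, -, rfl⟩ | ⟨i, -, hi⟩)
      · exact key _ (hF _ trivial)
      · obtain ⟨y, p, hp, rfl, -⟩ := hmem i x hi
        exact key _ hp.1
  have hcard := congrArg Finset.card hset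
  rw [Finset.card_union_of_disjoint, Finset.card_image_of_injective _ hinj,
    Finset.card_biUnion] at hcard
  · simp only [Int.card_Ico, Finset.card_univ, Fintype.card_fin] at hcard
    have h2 : ∀ i, (c i + a i - (c i - a i)).toNat = 2 * a i := fun i => by omega
    rw [Finset.sum_congr rfl fun i _ => h2 i, ← Finset.mul_sum] at hcard
    omega
  · intro i _ j _ hij
    rw [Function.onFun, Finset.disjoint_left]
    intro x hx hx'
    rw [Finset.mem_Ico] at hx hx'
    rcases hb.sep i j (by omega) (by omega) hij with h | h <;> omega
  · rw [Finset.disjoint_left]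
    intro x hx hx'
    obtain ⟨j, -, rfl⟩ := Finset.mem_image.1 hx
    obtain ⟨i, -, hi⟩ := Finset.mem_biUnion.1 hx'
    obtain ⟨y, p, hp, h1, -⟩ := hmem i _ hi
    obtain rfl := BdPt.coord_injective h1
    exact hp.2 (by rw [C.mate_mate]; trivial)

end LatticeCrossing

end

theorem corollary4p1 {m n k : ℕ} (C : LatticeCrossing.CatalanState m n)
    (hF : C.NoFloorReturns) (hC : C.Realizable)
    (a : Fin k → ℕ) (hT : C.TreeIsWedge a) :
    ∃ bM : Fin m → Fin (n + 1), C.IsLexMax bM ∧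
      C.coeff = LaurentPolynomial.T (2 * (LatticeCrossing.weight bM : ℤ) - (m : ℤ) * (n : ℤ)) *
        Polynomial.aeval (LaurentPolynomial.T (-4) : LaurentPolynomial ℤ)
          (LatticeCrossing.qMultinomial a) := by
  classical
  obtain ⟨⟨φ, hφ⟩, hd⟩ := hT
  obtain ⟨c, hb, hR⟩ := LatticeCrossing.exists_centres φ hφ hd
  have hm := LatticeCrossing.sum_eq_of_isBranching hF hb hR
  -- Start with all strands free and no arc made; the `m` rows have to produce exactly the `∑ a i`
  -- arcs.
  obtain ⟨hsum, bM, hg, hw, hlex⟩ := LatticeCrossing.seqSum_isStage hb hR m id 0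
    LatticeCrossing.isStage_zero (by simpa using hm)
  have hseq : ∀ b, b ∈ C.seqs ↔ LatticeCrossing.GoodSeq C.Arc id b :=
    LatticeCrossing.realizes_stateOf_iff hF
  refine ⟨bM, ⟨⟨bM, (hseq bM).2 hg, rfl⟩, ?_⟩, ?_⟩
  · rintro _ ⟨b, hb', rfl⟩
    exact hlex b ((hseq b).1 hb')
  · have h1 : C.coeff = LaurentPolynomial.T (-((m : ℤ) * n)) *
        LatticeCrossing.seqSum n C.Arc m id := by
      rw [LatticeCrossing.CatalanState.coeff_eq_sum_seqs hF, LatticeCrossing.seqSum,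
        Finset.mul_sum]
      refine Finset.sum_congr rfl fun b _ => ?_
      split_ifs
      · rw [← LaurentPolynomial.T_add]
        congr 1
        ring
      · rw [mul_zero]
    rw [h1, hsum, ← hw, ← mul_assoc, ← LaurentPolynomial.T_add]
    congr 2
    ring
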